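/- Let $G$ be a Lie group with Lie algebra $\mathfrak g$ and Killing form $B$, acting smoothly and transitively on a manifold $M$, let $o\in M$, let $H$ be the stabilizer of $o$ with isotropy algebra $\mathfrak h=\{X\in\mathfrak g : X(o)=0\}$, where $X(q)=\frac{d}{dt}\big|_{t=0}\exp(tX)\cdot q$, and suppose that $M=G/H$ as a manifold (i.e. the orbit map $G\to M$, $a\mapsto a\cdot o$, is a submersion). Assume that the presentation $G/H$ is almost-effective, i.e. that $\bigcap_{a\in G}aHa^{-1}$ is finite, and let $K\lhd G$ be a compact normal subgroup that is non-abelian in the sense that its Lie algebra $\mathfrak k$ is non-abelian (for connected $K$, or for connected $G$, this is the same as $K$ being non-abelian). Put $\mathfrak s=[\mathfrak k,\mathfrak k]$. (i) If $H$ is compact, then there is an $\mathrm{Ad}(KH)$-invariant inner product on $\mathfrak g$. (ii) Let $\langle\cdot,\cdot\rangle$ be any $\mathrm{Ad}(KH)$-invariant inner product on $\mathfrak g$, and let $\mathfrak m_{\mathfrak k}$ be the $\langle\cdot,\cdot\rangle$-orthogonal complement of $\mathfrak s\cap\mathfrak h$ in $\mathfrak s$. Then there is a constant $c>0$, independent of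 any Riemannian metric on $M$, such that $-\tfrac14B(X,X)\ge c$ for every $X\in\mathfrak m_{\mathfrak k}$ with $\langle X,X\rangle=1$, and such that the following holds for every $G$-invariant smooth Riemannian metric $g$ on $M$. Let $P$ be the $\langle\cdot,\cdot\rangle$-symmetric operator on $\mathfrak m_{\mathfrak k}$ defined by $g_o(X(o),Y(o))=\langle PX,Y\rangle$ for $X,Y\in\mathfrak m_{\mathfrak k}$. Then $P$ has a largest eigenvalue, this eigenvalue has an eigenvector $X\in\mathfrak m_{\mathfrak k}$ with $\langle X,X\rangle=1$, and every such $X$ satisfies $$\mathrm{ric}_g\big(X(o),X(o)\big)\ \ge\ -\tfrac14\,B(X,X)\ \ge\ c\ >\ 0 .$$ -/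

import Mathlib

open scoped Manifold ContDiff

noncomputable section

namespace HomogeneousRicci

/-! ### Ricci curvature of a Riemannian metric, in the preferred chart at a point -/

section LocalRicci

variable {E : Type*} [NormedAddCommGroup E] [NormedSpace ℝ E] [FiniteDimensional ℝ E]

/-- The Levi-Civita Christoffel symbols `Γ_x(u, v)` of a metric `h` on (an open subset of) a vector
space: `Γ_x(u, v)` is the vector `z` with
`2 h_x(z, w) = (D_u h)(v, w) + (D_v h)(u, w) - (D_w h)(u, v)` for all `w`. -/
def christoffel (h : E → E →L[ℝ] E →L[ℝ] ℝ) (x u v : E) : E :=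
  (h x).inverse ((1 / 2 : ℝ) •
    (fderiv ℝ h x u v + fderiv ℝ h x v u - ((fderiv ℝ h x).flip u).flip v))

/-- The Riemann curvature tensor `R(w, u) v = ∇_w ∇_u v - ∇_u ∇_w v` for constant
vector fields `w, u, v`, where `∇_w Y = D_w Y + Γ(w, Y)`. -/
def localRiemann (h : E → E →L[ℝ] E →L[ℝ] ℝ) (x w u v : E) : E :=
  fderiv ℝ (fun y => christoffel h y u v) x w + christoffel h x w (christoffel h x u v)
    - fderiv ℝ (fun y => christoffel h y w v) x u - christoffel h x u (christoffel h x w v)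

/-- The Ricci tensor `ric(u, v) = tr (w ↦ R(w, u) v)`. -/
def localRicci (h : E → E →L[ℝ] E →L[ℝ] ℝ) (x u v : E) : ℝ :=
  ∑ i, (Module.finBasis ℝ E).repr (localRiemann h x (Module.finBasis ℝ E i) u v) i

end LocalRicci

section Manifold

variable {E : Type*} [NormedAddCommGroup E] [NormedSpace ℝ E] [FiniteDimensional ℝ E]
  {M : Type*} [TopologicalSpace M] [ChartedSpace E M] [IsManifold 𝓘(ℝ, E) ∞ M]

variable (E M) in
/-- Smooth Riemannian metrics on the manifold `M`. -/
abbrev Metric : Type _ :=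
  Bundle.ContMDiffRiemannianMetric 𝓘(ℝ, E) ∞ E (fun x : M => TangentSpace 𝓘(ℝ, E) x)

/-- The metric `g` read in the preferred chart at `p`, i.e. the pullback of `g` under the inverse
of that chart. -/
def chartMetric (g : Metric E M) (p : M) (y : E) : E →L[ℝ] E →L[ℝ] ℝ :=
  let q : M := (extChartAt 𝓘(ℝ, E) p).symm y
  let A : E →L[ℝ] E := mfderiv 𝓘(ℝ, E) 𝓘(ℝ, E) (extChartAt 𝓘(ℝ, E) p).symm y
  let B : E →L[ℝ] E →L[ℝ] ℝ := g.inner q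
  B.bilinearComp A A

/-- The Ricci tensor of `g` at `p`. -/
def ricci (g : Metric E M) (p : M) (v w : TangentSpace 𝓘(ℝ, E) p) : ℝ :=
  localRicci (chartMetric g p) (extChartAt 𝓘(ℝ, E) p p)
    (mfderiv 𝓘(ℝ, E) 𝓘(ℝ, E) (extChartAt 𝓘(ℝ, E) p) p v)
    (mfderiv 𝓘(ℝ, E) 𝓘(ℝ, E) (extChartAt 𝓘(ℝ, E) p) p w)

end Manifold

/-! ### Lie groups and their Lie algebras -/

section LieGroup

variable {EG : Type*} [NormedAddCommGroup EG] [NormedSpace ℝ EG]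
  {G : Type*} [TopologicalSpace G] [ChartedSpace EG G] [Group G] [LieGroup 𝓘(ℝ, EG) ∞ G]

/-- A smooth Lie group has the regularity that Mathlib asks for in order to define its
Lie algebra. -/
instance instLieGroupMinSmoothness : LieGroup 𝓘(ℝ, EG) (minSmoothness ℝ 3) G :=
  LieGroup.of_le (n := ∞) (by simp only [minSmoothness_of_isRCLikeNormedField]; exact ENat.LEInfty.out)

variable (EG G) in
/-- The Lie algebra `𝔤 = T_1 G` of `G`. -/
abbrev LieAlg : Type _ := GroupLieAlgebra 𝓘(ℝ, EG) G

/-- The adjoint action `Ad(a) : 𝔤 → 𝔤`, the derivative at `1` of the conjugation by `a`. -/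
def Ad (a : G) (X : LieAlg EG G) : LieAlg EG G :=
  (mfderiv 𝓘(ℝ, EG) 𝓘(ℝ, EG) (fun x : G => a * x * a⁻¹) 1 X : EG)

variable (EG) in
/-- The Lie algebra of a closed subgroup `K` of `G`: the velocities at `1` of the smooth curves
in `G` that start at `1` and stay in `K`. -/
def lieSet (K : Subgroup G) : Set (LieAlg EG G) :=
  {X | ∃ γ : ℝ → G, ContMDiff 𝓘(ℝ, ℝ) 𝓘(ℝ, EG) ∞ γ ∧ γ 0 = 1 ∧ (∀ t, γ t ∈ K) ∧
    (mfderiv 𝓘(ℝ, ℝ) 𝓘(ℝ, EG) γ 0 (1 : ℝ) : EG) = X}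

variable (EG) in
/-- The derived algebra `[𝔨, 𝔨]` of `𝔨 = Lie(K)`, as a linear subspace of `𝔤`. -/
def derivedLie (K : Subgroup G) : Submodule ℝ (LieAlg EG G) :=
  Submodule.span ℝ {Z | ∃ X ∈ lieSet EG K, ∃ Y ∈ lieSet EG K, ⁅X, Y⁆ = Z}

/-- `Q` is an inner product on `𝔤` that is invariant under `Ad(C)`. -/
structure IsAdInvariantInner (Q : LinearMap.BilinForm ℝ (LieAlg EG G)) (C : Subgroup G) :
    Prop where
  symm : ∀ X Y, Q X Y = Q Y X
  pos : ∀ X, X ≠ 0 → 0 < Q X X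
  invariant : ∀ a ∈ C, ∀ X Y, Q (Ad a X) (Ad a Y) = Q X Y

end LieGroup

/-! ### Homogeneous spaces -/

section Homogeneous

variable {EG : Type*} [NormedAddCommGroup EG] [NormedSpace ℝ EG]
  {G : Type*} [TopologicalSpace G] [ChartedSpace EG G] [Group G] [LieGroup 𝓘(ℝ, EG) ∞ G]
  {E : Type*} [NormedAddCommGroup E] [NormedSpace ℝ E]
  {M : Type*} [TopologicalSpace M] [ChartedSpace E M] [MulAction G M]

variable (EG G E) in
/-- The derivative at `1` of the orbit map `a ↦ a • q`. It maps `X ∈ 𝔤` to the value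
`X(q) = d/dt|_{t=0} exp(tX) • q` at `q` of the vector field that `X` induces on `M`. -/
def fundVec (q : M) : LieAlg EG G →ₗ[ℝ] E where
  toFun X := (mfderiv 𝓘(ℝ, EG) 𝓘(ℝ, E) (fun a : G => a • q) 1 X : E)
  map_add' X Y := map_add (mfderiv 𝓘(ℝ, EG) 𝓘(ℝ, E) (fun a : G => a • q) 1) X Y
  map_smul' c X := map_smul (mfderiv 𝓘(ℝ, EG) 𝓘(ℝ, E) (fun a : G => a • q) 1) c X

variable (EG G E) in
/-- `M` is the homogeneous space `G/H`, where `H` is the stabilizer of the base point `o`: the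
(smooth) action of `G` on `M` is transitive and the orbit map `G → M`, `a ↦ a • o` is a submersion
at `1` (hence everywhere), so that it induces a diffeomorphism `G/H ≃ M`. -/
structure IsPresentation (o : M) : Prop where
  transitive : MulAction.IsPretransitive G M
  submersion : Function.Surjective (fundVec EG G E o)

variable (G) in
/-- The presentation `G/H` given by the base point `o` is almost-effective: the ineffective kernel
`⋂ a, a H a⁻¹` is finite. -/
def IsAlmostEffective (o : M) : Prop :=
  ((MulAction.stabilizer G o).normalCore : Set G).Finite

variable (EG E) in
/-- The subspace `𝔪_𝔨` of `𝔤`: the `Q`-orthogonal complement of `[𝔨, 𝔨] ∩ 𝔥` in `[𝔨, 𝔨]`,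
where `𝔥` is the isotropy algebra at `o`, the space of those `X ∈ 𝔤` with `X(o) = 0`. -/
def mk (K : Subgroup G) (o : M) (Q : LinearMap.BilinForm ℝ (LieAlg EG G)) :
    Submodule ℝ (LieAlg EG G) :=
  derivedLie EG K ⊓ Q.orthogonal (derivedLie EG K ⊓ LinearMap.ker (fundVec EG G E o))

section Metric

variable [IsManifold 𝓘(ℝ, E) ∞ M]

variable (G) in
/-- The metric `g` is `G`-invariant: every `a ∈ G` acts on `M` by an isometry of `g`. -/
def IsInvariantMetric (g : Metric E M) : Prop :=
  ∀ (a : G) (q : M) (v w : TangentSpace 𝓘(ℝ, E) q),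
    g.inner (a • q) (mfderiv 𝓘(ℝ, E) 𝓘(ℝ, E) (fun x : M => a • x) q v)
      (mfderiv 𝓘(ℝ, E) 𝓘(ℝ, E) (fun x : M => a • x) q w) = g.inner q v w

/-- The bilinear form `(X, Y) ↦ g_o(X(o), Y(o))` on `𝔤`. -/
def pulledBack (g : Metric E M) (o : M) (X Y : LieAlg EG G) : ℝ :=
  g.inner o (fundVec EG G E o X) (fundVec EG G E o Y)

/-- `X` is an eigenvector, with eigenvalue `p`, of the `Q`-symmetric operator `P` on the subspace
`V` of `𝔤` that is defined by `g_o(Y(o), Z(o)) = Q(P Y, Z)` for `Y, Z ∈ V`. -/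
def IsEigen (g : Metric E M) (o : M) (Q : LinearMap.BilinForm ℝ (LieAlg EG G))
    (V : Submodule ℝ (LieAlg EG G)) (p : ℝ) (X : LieAlg EG G) : Prop :=
  X ∈ V ∧ X ≠ 0 ∧ ∀ Z ∈ V, pulledBack g o X Z = p * Q X Z

end Metric

end Homogeneous

end HomogeneousRicci

end

/-!
Write `X(q)` for the value at `q` of the Killing field of an invariant metric `g` defined by
`X ∈ 𝔤`, let `b(X, Y) = g_o(X(o), Y(o))`, `B` the Killing form, `Q` the given inner product and
`𝔰 = [𝔨, 𝔨]`.

*The Lie algebra side.* As `Ad(K)` preserves `Q`, the operators `ad X` with `X ∈ 𝔨`, hence those with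
`X ∈ 𝔰`, are `Q`-skew on all of `𝔤`. As `K` is normal, `𝔰` is invariant under `Ad(G)`, hence an
ideal, and it has no central elements of `𝔤`, since these are orthogonal to all brackets in `𝔨`
(`isSkewIdeal_derivedLie`). It follows that `B` is negative definite on `𝔰`
(`IsSkewIdeal.killingForm_neg`), which provides the constant `c`. The complement `𝔪_𝔨` of `𝔰 ∩ 𝔥` is
nonzero: otherwise the fields of all elements of `𝔰` would vanish at `o` and, by `Ad(G)`-invariance,
everywhere; an integral curve in `G` would then act trivially on `M`, and so stay in the finite
ineffective kernel (`eq_zero_of_fundVec_eq_zero`, `derivedLie_not_le_ker`).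

*The geometric side.* For a Killing field `ξ` one has `ric(ξ, ξ) = -½ Δ⟨ξ, ξ⟩ + |∇ξ|²`. Let `X` be a
unit eigenvector for the largest eigenvalue `p` of `P`. Then `⟨ξ, ξ⟩` is critical at `o` for the
field `ξ` of `X`, with Hessian `-(p Q([X, Y], [X, Y]) - b([X, Y], [X, Y]))`, up to a positive factor,
in the direction `Y(o)`. This is negative semidefinite because `p` is maximal and `[X, Y] ∈ 𝔰`. So
both terms in the formula are sums of nonnegative terms over any orthonormal frame, and one may
discard the vectors of the frame that do not come from `𝔪_𝔨` (`IsKillingFamily.le_localRicci`,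
`le_ricci`). The Killing equation and the brackets of the fields come from the derivatives of the
action read in charts (`IsLocalAction.isLocalKilling`, `IsLocalAction.fundField_bracket`,
`exists_hasFDerivAt_Ad`).

*The comparison.* Let `e_i` be a `Q`-orthonormal eigenbasis of `𝔪_𝔨`, with eigenvalues `λ_i ≤ p`, and
let `c_ij = Q([X, e_i], e_j)`, which is antisymmetric. In the frame `e_i / √λ_i` the lower bound for
the Ricci curvature is
`∑_i (p |[X, e_i]|² - ∑_j λ_j c_ij²) / λ_i + ¼ ∑_ij (λ_i + λ_j - p)² c_ij² / (λ_i λ_j)`,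
while `-B(X, X) = -tr (ad X)² = 2 ∑_i |[X, e_i]|² - ∑_ij c_ij²`, because `ad X` vanishes on the
complement of `𝔰` and maps `𝔰 ∩ 𝔥` into `𝔪_𝔨` (`IsDiagonalFrame.neg_killingForm`). After
symmetrization in `i` and `j` the inequality between the first expression and a quarter of the second
reduces to `a² - ab + b² ≤ p²` for `0 < a, b ≤ p` (`quarter_le_of_antisymm`).

The invariant inner product for compact `H` is an average over the compact group `KH`
(`exists_isAdInvariantInner`).
-/

noncomputable section

set_option maxSynthPendingDepth 3
set_option linter.unusedSectionVars false

namespace HomogeneousRicci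

/-! ### Orthonormal families of positive definite bilinear forms -/

section LinearAlgebra

variable {V : Type*} [AddCommGroup V] [Module ℝ V]

/-- The family `e` is orthonormal for the bilinear form `Q`. A bilinear form is used instead of an
inner product space structure because several forms live on the same space, which moreover carries
an unrelated norm. -/
def OrthonormalFor {ι : Type*} [DecidableEq ι] (Q : LinearMap.BilinForm ℝ V) (e : ι → V) : Prop :=
  ∀ i j, Q (e i) (e j) = if i = j then 1 else 0

/-- The inner product space core of a positive definite symmetric bilinear form. -/
abbrev innerCore (Q : LinearMap.BilinForm ℝ V) (hs : ∀ x y, Q x y = Q y x)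
    (hp : ∀ x, x ≠ 0 → 0 < Q x x) : InnerProductSpace.Core ℝ V where
  inner x y := Q x y
  conj_inner_symm x y := by simpa using hs y x
  re_inner_nonneg x := by
    by_cases h : x = 0
    · simp [h]
    · simpa using (hp x h).le
  add_left x y z := by simp
  smul_left x y r := by simp
  definite x h := by
    by_contra h0
    exact (hp x h0).ne' h

/-- Simultaneous diagonalization of a symmetric form with respect to a positive definite one. -/
theorem exists_orthonormalFor_diagonal [FiniteDimensional ℝ V] (Q P : LinearMap.BilinForm ℝ V)
    (hs : ∀ x y, Q x y = Q y x) (hp : ∀ x, x ≠ 0 → 0 < Q x x) (hP : ∀ x y, P x y = P y x) :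
    ∃ (b : Module.Basis (Fin (Module.finrank ℝ V)) ℝ V) (μ : Fin (Module.finrank ℝ V) → ℝ),
      OrthonormalFor Q b ∧ ∀ i x, P (b i) x = μ i * Q (b i) x := by
  classical
  let _ : NormedAddCommGroup V := (innerCore Q hs hp).toNormedAddCommGroup
  let _ : InnerProductSpace ℝ V := InnerProductSpace.ofCore (innerCore Q hs hp).toCore
  have hin : ∀ x y : V, inner ℝ x y = Q x y := fun x y => rfl
  let T : V →ₗ[ℝ] V :=
    { toFun := fun x => (InnerProductSpace.toDual ℝ V).symm (LinearMap.toContinuousLinearMap (P x))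
      map_add' := fun x y => by simp
      map_smul' := fun c x => by simp }
  have hT : ∀ x y, inner ℝ (T x) y = P x y := fun x y => by
    simp [T]
  have hsym : T.IsSymmetric := fun x y => by
    rw [hT, real_inner_comm, hT, hP]
  refine ⟨(hsym.eigenvectorBasis rfl).toBasis, fun i => hsym.eigenvalues rfl i, ?_, ?_⟩
  · intro i j
    rw [← hin]
    simpa using orthonormal_iff_ite.1 (hsym.eigenvectorBasis rfl).orthonormal i j
  · intro i x
    rw [← hT, ← hin]
    simp only [OrthonormalBasis.coe_toBasis]
    rw [hsym.apply_eigenvectorBasis rfl i]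
    simp [real_inner_smul_left]

/-- An orthonormal family extends to an orthonormal basis. -/
theorem OrthonormalFor.exists_basis [FiniteDimensional ℝ V] {n : ℕ} {Q : LinearMap.BilinForm ℝ V}
    (hs : ∀ x y, Q x y = Q y x) (hp : ∀ x, x ≠ 0 → 0 < Q x x) {e : Fin n → V}
    (he : OrthonormalFor Q e) :
    ∃ (m : ℕ) (b : Module.Basis (Fin n ⊕ Fin m) ℝ V), OrthonormalFor Q b ∧
      ∀ i, b (Sum.inl i) = e i := by
  classical
  let _ : NormedAddCommGroup V := (innerCore Q hs hp).toNormedAddCommGroup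
  let _ : InnerProductSpace ℝ V := InnerProductSpace.ofCore (innerCore Q hs hp).toCore
  have hin : ∀ x y : V, inner ℝ x y = Q x y := fun x y => rfl
  have hon : Orthonormal ℝ e := orthonormal_iff_ite.2 he
  have hcard : n ≤ Module.finrank ℝ V := by
    simpa using hon.linearIndependent.fintype_card_le_finrank
  obtain ⟨m, hm⟩ := Nat.exists_eq_add_of_le hcard
  have hon' : Orthonormal ℝ ((Set.range (Sum.inl : Fin n → Fin n ⊕ Fin m)).domRestrict
      (Sum.elim e 0)) := by
    rw [orthonormal_iff_ite]
    rintro ⟨_, i, rfl⟩ ⟨_, j, rfl⟩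
    have h := orthonormal_iff_ite.1 hon i j
    simp only [Set.domRestrict_apply, Sum.elim_inl]
    rw [h]
    exact if_congr (by rw [Subtype.ext_iff, Sum.inl.injEq]) rfl rfl
  obtain ⟨b, hb⟩ := hon'.exists_orthonormalBasis_extension_of_card_eq (by simp [hm])
  refine ⟨m, b.toBasis, fun i j => ?_, fun i => ?_⟩
  · rw [← hin]
    simpa using orthonormal_iff_ite.1 b.orthonormal i j
  · simpa using hb (Sum.inl i) ⟨i, rfl⟩

variable {ι : Type*} [Fintype ι] [DecidableEq ι] {Q : LinearMap.BilinForm ℝ V}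

theorem OrthonormalFor.repr_eq {b : Module.Basis ι ℝ V} (hb : OrthonormalFor Q b) (x : V) (i : ι) :
    b.repr x i = Q x (b i) := by
  conv_rhs => rw [← b.sum_repr x]
  simp only [map_sum, map_smul, LinearMap.sum_apply, LinearMap.smul_apply, hb _ i]
  simp

theorem OrthonormalFor.sum_smul {b : Module.Basis ι ℝ V} (hb : OrthonormalFor Q b) (x : V) :
    ∑ i, Q x (b i) • b i = x := by
  simp_rw [← hb.repr_eq]
  exact b.sum_repr x

theorem OrthonormalFor.sum_mul {b : Module.Basis ι ℝ V} (hb : OrthonormalFor Q b) (x y : V) :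
    ∑ i, Q x (b i) * Q (b i) y = Q x y := by
  conv_rhs => rw [← hb.sum_smul x]
  simp

theorem OrthonormalFor.trace_eq {b : Module.Basis ι ℝ V} (hb : OrthonormalFor Q b)
    (T : V →ₗ[ℝ] V) : LinearMap.trace ℝ V T = ∑ i, Q (T (b i)) (b i) := by
  rw [LinearMap.trace_eq_matrix_trace ℝ b]
  simp [Matrix.trace, LinearMap.toMatrix_apply, hb.repr_eq]

/-- Bessel's inequality. -/
theorem OrthonormalFor.sum_sq_le [FiniteDimensional ℝ V] {n : ℕ}
    (hs : ∀ x y, Q x y = Q y x) (hp : ∀ x, x ≠ 0 → 0 < Q x x) {e : Fin n → V}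
    (he : OrthonormalFor Q e) (x : V) : ∑ i, Q x (e i) ^ 2 ≤ Q x x := by
  obtain ⟨m, b, hb, hbe⟩ := he.exists_basis hs hp
  rw [← hb.sum_mul x x, Fintype.sum_sum_type]
  have h1 : ∑ i, Q x (e i) ^ 2 = ∑ i, Q x (b (Sum.inl i)) * Q (b (Sum.inl i)) x := by
    refine Finset.sum_congr rfl fun i _ => ?_
    rw [hbe, hs (e i) x, sq]
  have h2 : 0 ≤ ∑ i, Q x (b (Sum.inr i)) * Q (b (Sum.inr i)) x := by
    refine Finset.sum_nonneg fun i _ => ?_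
    rw [hs (b _) x]
    exact mul_self_nonneg _
  linarith

/-- The trace of an operator with nonnegative diagonal is at least the sum over part of the
diagonal. -/
theorem OrthonormalFor.sum_le_trace [FiniteDimensional ℝ V] {n : ℕ}
    (hs : ∀ x y, Q x y = Q y x) (hp : ∀ x, x ≠ 0 → 0 < Q x x) {e : Fin n → V}
    (he : OrthonormalFor Q e) (T : V →ₗ[ℝ] V) (hT : ∀ x, 0 ≤ Q (T x) x) :
    ∑ i, Q (T (e i)) (e i) ≤ LinearMap.trace ℝ V T := by
  obtain ⟨m, b, hb, hbe⟩ := he.exists_basis hs hp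
  rw [hb.trace_eq, Fintype.sum_sum_type]
  simp only [hbe]
  exact le_add_of_nonneg_right (Finset.sum_nonneg fun i _ => hT _)

/-- If a skew operator `D` maps the orthogonal complement of the span of the orthonormal family `e`
into that span, then `-tr D²` counts the matrix coefficients of `D` that join the span to its
complement twice, and those inside of the span once. -/
theorem OrthonormalFor.trace_skew_sq [FiniteDimensional ℝ V] {n : ℕ}
    (hs : ∀ x y, Q x y = Q y x) (hp : ∀ x, x ≠ 0 → 0 < Q x x) {e : Fin n → V}
    (he : OrthonormalFor Q e) (D : V →ₗ[ℝ] V) (hD : ∀ x y, Q (D x) y = -Q x (D y))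
    (hW : ∀ x, (∀ i, Q x (e i) = 0) → ∀ y, (∀ i, Q y (e i) = 0) → Q (D x) y = 0) :
    -LinearMap.trace ℝ V (D ∘ₗ D) =
      2 * ∑ i, Q (D (e i)) (D (e i)) - ∑ i, ∑ j, Q (D (e i)) (e j) ^ 2 := by
  obtain ⟨m, b, hb, hbe⟩ := he.exists_basis hs hp
  have hr : ∀ (j : Fin m) (i : Fin n), Q (b (Sum.inr j)) (e i) = 0 := fun j i => by
    rw [← hbe, hb]; simp
  have key : ∀ x, Q (D x) (D x) = ∑ i, Q (D x) (e i) ^ 2 + ∑ j, Q (D x) (b (Sum.inr j)) ^ 2 := by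
    intro x
    rw [← hb.sum_mul (D x) (D x), Fintype.sum_sum_type]
    simp only [hbe]
    congr 1 <;> exact Finset.sum_congr rfl fun i _ => by rw [hs _ (D x), sq]
  have h2 : ∀ j, Q (D (b (Sum.inr j))) (D (b (Sum.inr j))) =
      ∑ i, Q (D (e i)) (b (Sum.inr j)) ^ 2 := by
    intro j
    rw [key]
    have : ∀ k, Q (D (b (Sum.inr j))) (b (Sum.inr k)) = 0 := fun k => hW _ (hr j) _ (hr k)
    simp only [this]
    simp only [ne_eq, OfNat.ofNat_ne_zero, not_false_eq_true, zero_pow, Finset.sum_const_zero,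
      add_zero]
    refine Finset.sum_congr rfl fun i _ => ?_
    rw [hD, hs, neg_sq]
  rw [hb.trace_eq, Fintype.sum_sum_type]
  simp only [hbe, LinearMap.comp_apply, hD (D _), h2]
  have h3 : ∀ i, Q (D (e i)) (D (e i)) - ∑ j, Q (D (e i)) (e j) ^ 2 =
      ∑ j, Q (D (e i)) (b (Sum.inr j)) ^ 2 := fun i => by rw [key (e i)]; ring
  have h4 : ∑ j, ∑ i, Q (D (e i)) (b (Sum.inr j)) ^ 2 =
      ∑ i, Q (D (e i)) (D (e i)) - ∑ i, ∑ j, Q (D (e i)) (e j) ^ 2 := by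
    rw [Finset.sum_comm, ← Finset.sum_sub_distrib]
    exact Finset.sum_congr rfl fun i _ => (h3 i).symm
  simp only [Finset.sum_neg_distrib, h4]
  ring

/-- Two positive definite forms on a finite-dimensional space are comparable. -/
theorem exists_pos_mul_le [FiniteDimensional ℝ V]
    {Q P : LinearMap.BilinForm ℝ V} (hs : ∀ x y, Q x y = Q y x) (hp : ∀ x, x ≠ 0 → 0 < Q x x)
    (hP : ∀ x y, P x y = P y x) (hPp : ∀ x, x ≠ 0 → 0 < P x x) :
    ∃ c : ℝ, 0 < c ∧ ∀ x, c * Q x x ≤ P x x := by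
  obtain ⟨f, μ, hf, hμ⟩ := exists_orthonormalFor_diagonal Q P hs hp hP
  have hpos : ∀ i, 0 < μ i := fun i => by
    have h := hμ i (f i)
    rw [hf, if_pos rfl, mul_one] at h
    exact h ▸ hPp _ (f.ne_zero i)
  obtain ⟨c, hc0, hc⟩ : ∃ c : ℝ, 0 < c ∧ ∀ i, c ≤ μ i := by
    rcases isEmpty_or_nonempty (Fin (Module.finrank ℝ V)) with h | h
    · exact ⟨1, one_pos, fun i => isEmptyElim i⟩
    · obtain ⟨i, hi⟩ := Finite.exists_min μ
      exact ⟨μ i, hpos i, hi⟩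
  refine ⟨c, hc0, fun x => ?_⟩
  have h1 : P x x = ∑ i, μ i * Q x (f i) ^ 2 := by
    conv_lhs => enter [1]; rw [← hf.sum_smul x]
    simp only [map_sum, map_smul, LinearMap.sum_apply, LinearMap.smul_apply, hμ, smul_eq_mul]
    refine Finset.sum_congr rfl fun i _ => ?_
    rw [hs (f i)]
    ring
  rw [h1, ← hf.sum_mul x x, Finset.mul_sum]
  refine Finset.sum_le_sum fun i _ => ?_
  rw [hs (f i), ← sq]
  exact mul_le_mul_of_nonneg_right (hc i) (sq_nonneg _)

end LinearAlgebra

/-! ### Killing fields of a metric on an open subset of a vector space -/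

section LocalKilling

open Filter Topology

variable {E : Type*} [NormedAddCommGroup E] [NormedSpace ℝ E]

/-- `h` is a `C²` Riemannian metric near `x₀`. -/
structure IsLocalMetric (h : E → E →L[ℝ] E →L[ℝ] ℝ) (x₀ : E) : Prop where
  contDiffAt : ContDiffAt ℝ 2 h x₀
  symm : ∀ᶠ y in 𝓝 x₀, ∀ v w, h y v w = h y w v
  pos : ∀ᶠ y in 𝓝 x₀, ∀ v, v ≠ 0 → 0 < h y v v

/-- `ξ` is a `C²` Killing field of the metric `h` near `x₀`, i.e. the Lie derivative of `h` along
`ξ` vanishes. -/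
structure IsLocalKilling (h : E → E →L[ℝ] E →L[ℝ] ℝ) (x₀ : E) (ξ : E → E) : Prop where
  contDiffAt : ContDiffAt ℝ 2 ξ x₀
  killing : ∀ᶠ y in 𝓝 x₀, ∀ v w,
    fderiv ℝ h y (ξ y) v w + h y (fderiv ℝ ξ y v) w + h y v (fderiv ℝ ξ y w) = 0

theorem fderiv_clm_apply₂ {F₁ F₂ F₃ : Type*} [NormedAddCommGroup F₁] [NormedSpace ℝ F₁]
    [NormedAddCommGroup F₂] [NormedSpace ℝ F₂] [NormedAddCommGroup F₃] [NormedSpace ℝ F₃]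
    {f : E → F₁ →L[ℝ] F₂ →L[ℝ] F₃} {a : E → F₁} {b : E → F₂} {x : E}
    (hf : DifferentiableAt ℝ f x) (ha : DifferentiableAt ℝ a x) (hb : DifferentiableAt ℝ b x)
    (u : E) :
    fderiv ℝ (fun y => f y (a y) (b y)) x u =
      fderiv ℝ f x u (a x) (b x) + f x (fderiv ℝ a x u) (b x) + f x (a x) (fderiv ℝ b x u) := by
  rw [fderiv_clm_apply (hf.clm_apply ha) hb, fderiv_clm_apply hf ha]
  simp only [add_apply, ContinuousLinearMap.comp_apply,
    ContinuousLinearMap.flip_apply]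
  abel

/-- The permutation of the arguments of a trilinear form that turns the derivative of a metric into
the Christoffel symbols of the first kind. -/
def koszulMap : (E →L[ℝ] E →L[ℝ] E →L[ℝ] ℝ) →L[ℝ] (E →L[ℝ] E →L[ℝ] E →L[ℝ] ℝ) :=
  let flip₁ : (E →L[ℝ] E →L[ℝ] E →L[ℝ] ℝ) →L[ℝ] (E →L[ℝ] E →L[ℝ] E →L[ℝ] ℝ) :=
    (ContinuousLinearMap.flipₗᵢ ℝ E E (E →L[ℝ] ℝ)).toContinuousLinearEquiv
  let flip₂ : (E →L[ℝ] E →L[ℝ] ℝ) →L[ℝ] (E →L[ℝ] E →L[ℝ] ℝ) :=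
    (ContinuousLinearMap.flipₗᵢ ℝ E E ℝ).toContinuousLinearEquiv
  (1 / 2 : ℝ) • (ContinuousLinearMap.id ℝ _ + flip₁ -
    (ContinuousLinearMap.compL ℝ E (E →L[ℝ] E →L[ℝ] ℝ) (E →L[ℝ] E →L[ℝ] ℝ) flip₂).comp flip₁)

theorem koszulMap_apply (D : E →L[ℝ] E →L[ℝ] E →L[ℝ] ℝ) (u v : E) :
    koszulMap D u v = (1 / 2 : ℝ) • (D u v + D v u - (D.flip u).flip v) := by
  ext w
  simp [koszulMap]

/-- The Christoffel symbols as a field of bilinear maps. -/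
def christoffelL (h : E → E →L[ℝ] E →L[ℝ] ℝ) (y : E) : E →L[ℝ] E →L[ℝ] E :=
  (ContinuousLinearMap.compL ℝ E (E →L[ℝ] ℝ) E (h y).inverse).comp (koszulMap (fderiv ℝ h y))

theorem christoffelL_apply (h : E → E →L[ℝ] E →L[ℝ] ℝ) (y u v : E) :
    christoffelL h y u v = christoffel h y u v := by
  simp only [christoffelL, ContinuousLinearMap.comp_apply, ContinuousLinearMap.compL_apply,
    koszulMap_apply, christoffel]

variable {h : E → E →L[ℝ] E →L[ℝ] ℝ} {x₀ : E} {ξ : E → E}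

theorem _root_.ContDiffAt.differentiableAt_fderiv {F : Type*} [NormedAddCommGroup F]
    [NormedSpace ℝ F] {f : E → F} {x : E} (hf : ContDiffAt ℝ 2 f x) :
    DifferentiableAt ℝ (fderiv ℝ f) x :=
  (hf.fderiv_right (m := 1) (by norm_num)).differentiableAt (by norm_num)

namespace IsLocalMetric

theorem differentiableAt (H : IsLocalMetric h x₀) : DifferentiableAt ℝ h x₀ :=
  H.contDiffAt.differentiableAt (by norm_num)

theorem eq_of_forall (H : IsLocalMetric h x₀) {a b : E} (hab : ∀ w, h x₀ a w = h x₀ b w) :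
    a = b := by
  by_contra hne
  have := H.pos.self_of_nhds (a - b) (sub_ne_zero.2 hne)
  simp [hab] at this

theorem fderiv_symm (H : IsLocalMetric h x₀) (u v w : E) :
    fderiv ℝ h x₀ u v w = fderiv ℝ h x₀ u w v := by
  have h1 : (fun y => h y v w) =ᶠ[𝓝 x₀] fun y => h y w v := H.symm.mono fun y hy => hy v w
  have h2 := DFunLike.congr_fun (EventuallyEq.fderiv_eq (𝕜 := ℝ) h1) u
  have hd := H.differentiableAt
  rw [fderiv_clm_apply₂ hd (differentiableAt_const _) (differentiableAt_const _),
    fderiv_clm_apply₂ hd (differentiableAt_const _) (differentiableAt_const _)] at h2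
  simpa using h2

end IsLocalMetric

theorem IsLocalKilling.differentiableAt (K : IsLocalKilling h x₀ ξ) : DifferentiableAt ℝ ξ x₀ :=
  K.contDiffAt.differentiableAt (by norm_num)

/-- The derivative of Killing's equation. -/
theorem IsLocalKilling.fderiv_killing (H : IsLocalMetric h x₀) (K : IsLocalKilling h x₀ ξ)
    (u v w : E) :
    fderiv ℝ (fderiv ℝ h) x₀ u (ξ x₀) v w + fderiv ℝ h x₀ (fderiv ℝ ξ x₀ u) v w
      + fderiv ℝ h x₀ u (fderiv ℝ ξ x₀ v) w + h x₀ (fderiv ℝ (fderiv ℝ ξ) x₀ u v) w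
      + fderiv ℝ h x₀ u v (fderiv ℝ ξ x₀ w) + h x₀ v (fderiv ℝ (fderiv ℝ ξ) x₀ u w) = 0 := by
  have h1 : (fun y => fderiv ℝ h y (ξ y) v w + h y (fderiv ℝ ξ y v) w + h y v (fderiv ℝ ξ y w))
      =ᶠ[𝓝 x₀] fun _ => 0 := K.killing.mono fun y hy => hy v w
  have h2 := DFunLike.congr_fun (EventuallyEq.fderiv_eq (𝕜 := ℝ) h1) u
  have dh := H.differentiableAt
  have dh' := H.contDiffAt.differentiableAt_fderiv
  have dξ := K.differentiableAt
  have dξ' := K.contDiffAt.differentiableAt_fderiv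
  have dv : ∀ v : E, DifferentiableAt ℝ (fun y => fderiv ℝ ξ y v) x₀ := fun v =>
    dξ'.clm_apply (differentiableAt_const _)
  have hv : ∀ v : E, fderiv ℝ (fun y => fderiv ℝ ξ y v) x₀ u = fderiv ℝ (fderiv ℝ ξ) x₀ u v := by
    intro v
    rw [fderiv_clm_apply dξ' (differentiableAt_const _)]
    simp
  have t1 : DifferentiableAt ℝ (fun y => fderiv ℝ h y (ξ y) v) x₀ :=
    (dh'.clm_apply dξ).clm_apply (differentiableAt_const _)
  have t2 : DifferentiableAt ℝ (fun y => h y (fderiv ℝ ξ y v) w) x₀ :=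
    (dh.clm_apply (dv v)).clm_apply (differentiableAt_const _)
  have t3 : DifferentiableAt ℝ (fun y => h y v (fderiv ℝ ξ y w)) x₀ :=
    (dh.clm_apply (differentiableAt_const _)).clm_apply (dv w)
  have t12 : DifferentiableAt ℝ
      (fun y => fderiv ℝ h y (ξ y) v w + h y (fderiv ℝ ξ y v) w) x₀ :=
    (t1.clm_apply (differentiableAt_const _)).add t2
  rw [fderiv_fun_add t12 t3,
    fderiv_fun_add (t1.clm_apply (differentiableAt_const _)) t2] at h2
  simp only [add_apply] at h2
  rw [fderiv_clm_apply₂ dh (dv v) (differentiableAt_const _),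
    fderiv_clm_apply₂ dh (differentiableAt_const _) (dv w),
    fderiv_clm_apply t1 (differentiableAt_const _)] at h2
  simp only [add_apply, ContinuousLinearMap.comp_apply, ContinuousLinearMap.flip_apply] at h2
  rw [fderiv_clm_apply₂ dh' dξ (differentiableAt_const _)] at h2
  simp only [hv, fderiv_fun_const, Pi.zero_apply, zero_apply, map_zero,
    add_zero, zero_add, add_apply] at h2
  linarith

variable [FiniteDimensional ℝ E]

theorem exists_equiv_of_pos {B : E →L[ℝ] E →L[ℝ] ℝ}
    (hB : ∀ v, v ≠ 0 → 0 < B v v) : ∃ e : E ≃L[ℝ] (E →L[ℝ] ℝ), (e : E →L[ℝ] E →L[ℝ] ℝ) = B := by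
  have hinj : Function.Injective (B : E →ₗ[ℝ] E →L[ℝ] ℝ) := by
    refine (injective_iff_map_eq_zero _).2 fun v hv => ?_
    by_contra h0
    have := hB v h0
    have h1 : B v = 0 := hv
    simp [h1] at this
  have hfr : Module.finrank ℝ E = Module.finrank ℝ (E →L[ℝ] ℝ) := by
    rw [← Subspace.dual_finrank_eq, ← LinearEquiv.finrank_eq
      (LinearMap.toContinuousLinearMap (𝕜 := ℝ) (E := E) (F' := ℝ))]
  refine ⟨(LinearEquiv.ofInjectiveOfFinrankEq _ hinj hfr).toContinuousLinearEquiv, ?_⟩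
  ext v w
  rfl

theorem christoffel_spec {y : E} (hpos : ∀ v, v ≠ 0 → 0 < h y v v) (u v w : E) :
    h y (christoffelL h y u v) w =
      1 / 2 * (fderiv ℝ h y u v w + fderiv ℝ h y v u w - fderiv ℝ h y w u v) := by
  obtain ⟨e, he⟩ := exists_equiv_of_pos hpos
  have : h y (christoffelL h y u v) = koszulMap (fderiv ℝ h y) u v := by
    simp only [christoffelL, ContinuousLinearMap.comp_apply, ContinuousLinearMap.compL_apply]
    rw [← he, ContinuousLinearMap.inverse_equiv]
    simp
  rw [this, koszulMap_apply]
  simp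

namespace IsLocalMetric

theorem differentiableAt_christoffelL (H : IsLocalMetric h x₀) :
    DifferentiableAt ℝ (christoffelL h) x₀ := by
  obtain ⟨e, he⟩ := exists_equiv_of_pos H.pos.self_of_nhds
  have h1 : DifferentiableAt ℝ (fun y => (h y).inverse) x₀ := by
    have h2 : DifferentiableAt ℝ (ContinuousLinearMap.inverse (R := ℝ) (M := E) (M₂ := E →L[ℝ] ℝ))
        (h x₀) := by
      rw [← he]
      exact (contDiffAt_map_inverse (n := 1) e).differentiableAt (by norm_num)
    exact h2.comp x₀ H.differentiableAt
  have h3 : DifferentiableAt ℝ (fun y => koszulMap (fderiv ℝ h y)) x₀ :=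
    koszulMap.differentiableAt.comp x₀ H.contDiffAt.differentiableAt_fderiv
  exact ((ContinuousLinearMap.differentiableAt _).comp x₀ h1).clm_comp h3

theorem christoffelL_symm (H : IsLocalMetric h x₀) (u v : E) :
    christoffelL h x₀ u v = christoffelL h x₀ v u := by
  refine H.eq_of_forall fun w => ?_
  rw [christoffel_spec H.pos.self_of_nhds, christoffel_spec H.pos.self_of_nhds,
    H.fderiv_symm w u v]
  ring

theorem fderiv_christoffel_spec (H : IsLocalMetric h x₀) (z u v w : E) :
    fderiv ℝ h x₀ z (christoffelL h x₀ u v) w + h x₀ (fderiv ℝ (christoffelL h) x₀ z u v) w =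
      1 / 2 * (fderiv ℝ (fderiv ℝ h) x₀ z u v w + fderiv ℝ (fderiv ℝ h) x₀ z v u w
        - fderiv ℝ (fderiv ℝ h) x₀ z w u v) := by
  have h1 : (fun y => h y (christoffelL h y u v) w) =ᶠ[𝓝 x₀] fun y => koszulMap (fderiv ℝ h y) u v w := by
    filter_upwards [H.pos] with y hy
    rw [christoffel_spec hy, koszulMap_apply]
    simp
  have h2 := DFunLike.congr_fun (EventuallyEq.fderiv_eq (𝕜 := ℝ) h1) z
  have dh := H.differentiableAt
  have dh' := H.contDiffAt.differentiableAt_fderiv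
  have dΓ := H.differentiableAt_christoffelL
  have dΓ' : DifferentiableAt ℝ (fun y => christoffelL h y u v) x₀ :=
    (dΓ.clm_apply (differentiableAt_const _)).clm_apply (differentiableAt_const _)
  have dk : DifferentiableAt ℝ (fun y => koszulMap (fderiv ℝ h y)) x₀ :=
    koszulMap.differentiableAt.comp x₀ dh'
  have hk : fderiv ℝ (fun y => koszulMap (fderiv ℝ h y)) x₀ =
      koszulMap.comp (fderiv ℝ (fderiv ℝ h) x₀) :=
    (koszulMap.hasFDerivAt.comp x₀ dh'.hasFDerivAt).fderiv
  rw [fderiv_clm_apply₂ dh dΓ' (differentiableAt_const _),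
    fderiv_clm_apply₂ dΓ (differentiableAt_const _) (differentiableAt_const _),
    fderiv_clm_apply ((dk.clm_apply (differentiableAt_const _)).clm_apply
      (differentiableAt_const _)) (differentiableAt_const _)] at h2
  simp only [add_apply, ContinuousLinearMap.comp_apply, ContinuousLinearMap.flip_apply] at h2
  rw [fderiv_clm_apply₂ dk (differentiableAt_const _) (differentiableAt_const _), hk] at h2
  simp only [ContinuousLinearMap.comp_apply, koszulMap_apply, fderiv_fun_const, Pi.zero_apply,
    zero_apply, map_zero, add_zero, zero_add] at h2
  rw [h2]
  simp

end IsLocalMetric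

namespace IsLocalKilling

/-- Killing fields are affine: the Lie derivative of the Levi-Civita connection along a Killing
field vanishes. -/
theorem lieDeriv_christoffel (H : IsLocalMetric h x₀) (K : IsLocalKilling h x₀ ξ) (u v : E) :
    fderiv ℝ (fderiv ℝ ξ) x₀ u v + fderiv ℝ (christoffelL h) x₀ (ξ x₀) u v
      + christoffelL h x₀ (fderiv ℝ ξ x₀ u) v + christoffelL h x₀ u (fderiv ℝ ξ x₀ v)
      = fderiv ℝ ξ x₀ (christoffelL h x₀ u v) := by
  refine H.eq_of_forall fun w => ?_
  have sh : ∀ a b, h x₀ a b = h x₀ b a := H.symm.self_of_nhds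
  have sξ : ∀ a b, fderiv ℝ (fderiv ℝ ξ) x₀ a b = fderiv ℝ (fderiv ℝ ξ) x₀ b a :=
    fun a b => (K.contDiffAt.isSymmSndFDerivAt (by simp)) a b
  have s2 : ∀ a b, fderiv ℝ (fderiv ℝ h) x₀ a b = fderiv ℝ (fderiv ℝ h) x₀ b a :=
    fun a b => (H.contDiffAt.isSymmSndFDerivAt (by simp)) a b
  have k0 := K.killing.self_of_nhds (christoffelL h x₀ u v) w
  have c := H.fderiv_christoffel_spec (ξ x₀) u v w
  have sp := christoffel_spec (h := h) H.pos.self_of_nhds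
  have e1 := K.fderiv_killing H u v w
  have e2 := K.fderiv_killing H v u w
  have e3 := K.fderiv_killing H w u v
  simp only [map_add, add_apply, sp] at k0 c ⊢
  rw [s2 u, sh v] at e1
  rw [s2 v, sh u, sξ v u] at e2
  rw [s2 w, sξ w u, sξ w v, sh u] at e3
  have d1 := H.fderiv_symm (fderiv ℝ ξ x₀ w) u v
  have d2 := H.fderiv_symm w (fderiv ℝ ξ x₀ u) v
  linarith

/-- The covariant derivative `v ↦ ∇_v ξ` at `x₀` of the field `ξ`. -/
def _root_.HomogeneousRicci.covDeriv (h : E → E →L[ℝ] E →L[ℝ] ℝ) (x₀ : E) (ξ : E → E) : E →L[ℝ] E :=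
  fderiv ℝ ξ x₀ + christoffelL h x₀ (ξ x₀)

theorem covDeriv_skew (H : IsLocalMetric h x₀) (K : IsLocalKilling h x₀ ξ) (v w : E) :
    h x₀ (covDeriv h x₀ ξ v) w = -h x₀ v (covDeriv h x₀ ξ w) := by
  have sh : ∀ a b, h x₀ a b = h x₀ b a := H.symm.self_of_nhds
  have k0 := K.killing.self_of_nhds v w
  have sp := christoffel_spec (h := h) H.pos.self_of_nhds
  simp only [covDeriv, add_apply, map_add, sh v (christoffelL h x₀ (ξ x₀) w), sp]
  linarith [H.fderiv_symm (ξ x₀) v w]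

/-- The acceleration `∇_ξ ξ` of the field `ξ`. -/
def _root_.HomogeneousRicci.accel (h : E → E →L[ℝ] E →L[ℝ] ℝ) (ξ : E → E) (y : E) : E :=
  fderiv ℝ ξ y (ξ y) + christoffelL h y (ξ y) (ξ y)

theorem differentiableAt_accel (H : IsLocalMetric h x₀) (K : IsLocalKilling h x₀ ξ) :
    DifferentiableAt ℝ (accel h ξ) x₀ :=
  (K.contDiffAt.differentiableAt_fderiv.clm_apply K.differentiableAt).add
    ((H.differentiableAt_christoffelL.clm_apply K.differentiableAt).clm_apply K.differentiableAt)

/-- For a Killing field `ξ`, the curvature `R(w, ξ) ξ` equals `∇_w (∇_ξ ξ) - ∇_{∇_w ξ} ξ`. -/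
theorem localRiemann_eq (H : IsLocalMetric h x₀) (K : IsLocalKilling h x₀ ξ) (w : E) :
    localRiemann h x₀ w (ξ x₀) (ξ x₀) =
      fderiv ℝ (accel h ξ) x₀ w + christoffelL h x₀ w (accel h ξ x₀)
        - covDeriv h x₀ ξ (covDeriv h x₀ ξ w) := by
  have dΓ := H.differentiableAt_christoffelL
  have dξ := K.differentiableAt
  have dξ' := K.contDiffAt.differentiableAt_fderiv
  have hc : ∀ u v z, fderiv ℝ (fun y => christoffelL h y u v) x₀ z =
      fderiv ℝ (christoffelL h) x₀ z u v := by
    intro u v z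
    rw [fderiv_clm_apply₂ dΓ (differentiableAt_const _) (differentiableAt_const _)]
    simp
  have hN : fderiv ℝ (accel h ξ) x₀ w = fderiv ℝ (fderiv ℝ ξ) x₀ w (ξ x₀)
      + fderiv ℝ ξ x₀ (fderiv ℝ ξ x₀ w) + fderiv ℝ (christoffelL h) x₀ w (ξ x₀) (ξ x₀)
      + christoffelL h x₀ (fderiv ℝ ξ x₀ w) (ξ x₀)
      + christoffelL h x₀ (ξ x₀) (fderiv ℝ ξ x₀ w) := by
    have : accel h ξ = fun y => fderiv ℝ ξ y (ξ y) + christoffelL h y (ξ y) (ξ y) := rfl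
    rw [this, fderiv_fun_add (dξ'.clm_apply dξ) ((dΓ.clm_apply dξ).clm_apply dξ), add_apply,
      fderiv_clm_apply₂ dΓ dξ dξ, fderiv_clm_apply dξ' dξ]
    simp only [add_apply, ContinuousLinearMap.comp_apply, ContinuousLinearMap.flip_apply]
    abel
  have hL := K.lieDeriv_christoffel H w (ξ x₀)
  have s1 := H.christoffelL_symm (ξ x₀) w
  simp only [localRiemann, ← christoffelL_apply, hc]
  rw [hN]
  simp only [accel, covDeriv, add_apply, map_add, s1, ← hL]
  abel

/-- The Ricci curvature in the direction of a Killing field `ξ` is the trace of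
`w ↦ ∇_w (∇_ξ ξ) - ∇_{∇_w ξ} ξ`, here at a point where `∇_ξ ξ` vanishes. -/
theorem localRicci_eq (H : IsLocalMetric h x₀) (K : IsLocalKilling h x₀ ξ)
    (h0 : accel h ξ x₀ = 0) :
    localRicci h x₀ (ξ x₀) (ξ x₀) =
      LinearMap.trace ℝ E ((fderiv ℝ (accel h ξ) x₀ -
        (covDeriv h x₀ ξ).comp (covDeriv h x₀ ξ) : E →L[ℝ] E) : E →ₗ[ℝ] E) := by
  rw [LinearMap.trace_eq_matrix_trace ℝ (Module.finBasis ℝ E)]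
  simp only [localRicci, K.localRiemann_eq H, h0, map_zero, add_zero, Matrix.trace,
    Matrix.diag_apply, LinearMap.toMatrix_apply]
  rfl

end IsLocalKilling

section Algebra

variable {𝔤 : Type*} [LieRing 𝔤]

/-- The fields `κ X` form a Lie algebra of Killing fields near `x₀` that span the space at `x₀`.
The sign in `bracket` is that of the fundamental fields of a left action. -/
structure IsKillingFamily (h : E → E →L[ℝ] E →L[ℝ] ℝ) (x₀ : E) (κ : 𝔤 → E → E) : Prop where
  killing : ∀ X, IsLocalKilling h x₀ (κ X)
  bracket : ∀ X Y, ∀ᶠ y in 𝓝 x₀,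
    fderiv ℝ (κ X) y (κ Y y) - fderiv ℝ (κ Y) y (κ X y) = κ ⁅X, Y⁆ y
  surjective : ∀ v, ∃ Y, κ Y x₀ = v

variable {κ : 𝔤 → E → E}

namespace IsKillingFamily

theorem accel_inner (H : IsLocalMetric h x₀) (K : IsKillingFamily h x₀ κ) (X Y : 𝔤) :
    ∀ᶠ y in 𝓝 x₀, h y (accel h (κ X) y) (κ Y y) = -h y (κ X y) (κ ⁅X, Y⁆ y) := by
  filter_upwards [H.pos, H.symm, K.bracket X Y, (K.killing X).killing, (K.killing Y).killing]
    with y hp hs hb hX hY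
  have sp := christoffel_spec (h := h) hp
  have k1 := hX (κ X y) (κ Y y)
  have k2 := hY (κ X y) (κ X y)
  rw [hs (κ X y) (fderiv ℝ (κ Y) y (κ X y))] at k2
  rw [← hb]
  simp only [accel, map_add, add_apply, sp, map_sub]
  rw [hs (κ X y) (fderiv ℝ (κ Y) y (κ X y))]
  linarith

theorem accel_eq_zero (H : IsLocalMetric h x₀) (K : IsKillingFamily h x₀ κ) {X : 𝔤}
    (hX : ∀ Y, h x₀ (κ X x₀) (κ ⁅X, Y⁆ x₀) = 0) : accel h (κ X) x₀ = 0 := by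
  refine H.eq_of_forall fun w => ?_
  obtain ⟨Y, rfl⟩ := K.surjective w
  rw [(K.accel_inner H X Y).self_of_nhds, hX]
  simp

theorem fderiv_accel_inner (H : IsLocalMetric h x₀) (K : IsKillingFamily h x₀ κ) {X : 𝔤}
    (hX : ∀ Y, h x₀ (κ X x₀) (κ ⁅X, Y⁆ x₀) = 0) (Y : 𝔤) :
    h x₀ (fderiv ℝ (accel h (κ X)) x₀ (κ Y x₀)) (κ Y x₀) =
      -(h x₀ (κ ⁅X, Y⁆ x₀) (κ ⁅X, Y⁆ x₀) + h x₀ (κ X x₀) (κ ⁅⁅X, Y⁆, Y⁆ x₀)) := by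
  have h2 := DFunLike.congr_fun (EventuallyEq.fderiv_eq (𝕜 := ℝ) (K.accel_inner H X Y)) (κ Y x₀)
  have dh := H.differentiableAt
  have dX := (K.killing X).differentiableAt
  have dY := (K.killing Y).differentiableAt
  have dZ := (K.killing ⁅X, Y⁆).differentiableAt
  have k := (K.killing Y).killing.self_of_nhds (κ X x₀) (κ ⁅X, Y⁆ x₀)
  rw [fderiv_clm_apply₂ dh ((K.killing X).differentiableAt_accel H) dY, fderiv_fun_neg,
    neg_apply, fderiv_clm_apply₂ dh dX dZ, K.accel_eq_zero H hX] at h2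
  rw [← (K.bracket ⁅X, Y⁆ Y).self_of_nhds]
  have hb := congrArg (fun z => h x₀ z (κ ⁅X, Y⁆ x₀)) (K.bracket X Y).self_of_nhds
  simp only [map_zero, zero_apply, add_zero, map_sub, sub_apply, zero_add] at h2 hb ⊢
  linarith

theorem two_mul_covDeriv (H : IsLocalMetric h x₀) (K : IsKillingFamily h x₀ κ) (X Y Z : 𝔤) :
    2 * h x₀ (covDeriv h x₀ (κ X) (κ Y x₀)) (κ Z x₀) =
      h x₀ (κ ⁅X, Y⁆ x₀) (κ Z x₀) + h x₀ (κ Y x₀) (κ ⁅Z, X⁆ x₀)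
        + h x₀ (κ X x₀) (κ ⁅Z, Y⁆ x₀) := by
  have sp := christoffel_spec (h := h) H.pos.self_of_nhds
  have sh : ∀ a b, h x₀ a b = h x₀ b a := H.symm.self_of_nhds
  have k1 := (K.killing X).killing.self_of_nhds (κ Y x₀) (κ Z x₀)
  have k2 := (K.killing Y).killing.self_of_nhds (κ X x₀) (κ Z x₀)
  have k3 := (K.killing Z).killing.self_of_nhds (κ X x₀) (κ Y x₀)
  simp only [← (K.bracket _ _).self_of_nhds, covDeriv, add_apply, map_add, sp, map_sub, sub_apply]
  linarith [sh (fderiv ℝ (κ Z) x₀ (κ X x₀)) (κ Y x₀)]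

/-- Lower bound for the Ricci curvature in the direction of a Killing field `ξ = κ X` of which the
squared length `⟨ξ, ξ⟩` is critical at `x₀`, with negative semidefinite Hessian there. It comes from
`ric(ξ, ξ) = -½ Δ⟨ξ, ξ⟩ + |∇ξ|²`: both terms are sums of nonnegative terms over an orthonormal
frame, and only those terms are kept that belong to a part of such a frame. -/
theorem le_localRicci (H : IsLocalMetric h x₀) (K : IsKillingFamily h x₀ κ) {X : 𝔤}
    (hX : ∀ Y, h x₀ (κ X x₀) (κ ⁅X, Y⁆ x₀) = 0)
    (hneg : ∀ Y, h x₀ (κ ⁅X, Y⁆ x₀) (κ ⁅X, Y⁆ x₀) + h x₀ (κ X x₀) (κ ⁅⁅X, Y⁆, Y⁆ x₀) ≤ 0)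
    {n : ℕ} (Y : Fin n → 𝔤)
    (hY : ∀ i j, h x₀ (κ (Y i) x₀) (κ (Y j) x₀) = if i = j then 1 else 0) :
    ∑ i, -(h x₀ (κ ⁅X, Y i⁆ x₀) (κ ⁅X, Y i⁆ x₀) + h x₀ (κ X x₀) (κ ⁅⁅X, Y i⁆, Y i⁆ x₀))
      + ∑ i, ∑ j, 1 / 4 * (h x₀ (κ ⁅X, Y i⁆ x₀) (κ (Y j) x₀)
          + h x₀ (κ (Y i) x₀) (κ ⁅Y j, X⁆ x₀) + h x₀ (κ X x₀) (κ ⁅Y j, Y i⁆ x₀)) ^ 2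
      ≤ localRicci h x₀ (κ X x₀) (κ X x₀) := by
  have sh : ∀ a b, h x₀ a b = h x₀ b a := H.symm.self_of_nhds
  rw [(K.killing X).localRicci_eq H (K.accel_eq_zero H hX)]
  let Q : LinearMap.BilinForm ℝ E := LinearMap.mk₂ ℝ (fun v w => h x₀ v w)
    (by simp) (by simp) (by simp) (by simp)
  have hQ : ∀ v w, Q v w = h x₀ v w := fun v w => rfl
  have hon : OrthonormalFor Q (fun i => κ (Y i) x₀) := hY
  have hT : ∀ v, Q (((fderiv ℝ (accel h (κ X)) x₀ -
      (covDeriv h x₀ (κ X)).comp (covDeriv h x₀ (κ X)) : E →L[ℝ] E) : E →ₗ[ℝ] E) v) v =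
      h x₀ (fderiv ℝ (accel h (κ X)) x₀ v) v
        + Q (covDeriv h x₀ (κ X) v) (covDeriv h x₀ (κ X) v) := by
    intro v
    simp only [ContinuousLinearMap.coe_coe, sub_apply, ContinuousLinearMap.comp_apply, map_sub,
      LinearMap.sub_apply, hQ]
    rw [(K.killing X).covDeriv_skew H (covDeriv h x₀ (κ X) v)]
    ring
  have hpos : ∀ v, v ≠ 0 → 0 < Q v v := H.pos.self_of_nhds
  have hnn : ∀ v, 0 ≤ Q v v := fun v => by
    by_cases h0 : v = 0
    · simp [h0]
    · exact (hpos v h0).le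
  refine le_trans ?_ (hon.sum_le_trace sh hpos _ fun v => ?_)
  · simp only [hT]
    rw [Finset.sum_add_distrib]
    refine add_le_add (le_of_eq (Finset.sum_congr rfl fun i _ =>
      (K.fderiv_accel_inner H hX (Y i)).symm)) (Finset.sum_le_sum fun i _ => ?_)
    refine le_trans (le_of_eq ?_) (hon.sum_sq_le sh hpos _)
    refine Finset.sum_congr rfl fun j _ => ?_
    rw [← K.two_mul_covDeriv H X (Y i) (Y j), hQ]
    ring
  · rw [hT]
    obtain ⟨Z, rfl⟩ := K.surjective v
    rw [K.fderiv_accel_inner H hX]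
    linarith [hneg Z, hnn (covDeriv h x₀ (κ X) (κ Z x₀))]

end IsKillingFamily

end Algebra

end LocalKilling

/-! ### Local actions and their fundamental fields -/

section LocalAction

open Filter Topology

variable {Z : Type*} [NormedAddCommGroup Z] [NormedSpace ℝ Z]
  {E : Type*} [NormedAddCommGroup E] [NormedSpace ℝ E]

/-- The value at `y` of the fundamental field of `X` for the map `F`, which plays the role of an
action, read in charts, of a neighbourhood of the neutral element `e` of a group. -/
def fundField (F : Z × E → E) (e : Z) (X : Z) (y : E) : E := fderiv ℝ F (e, y) (X, 0)

/-- `F` is `C³` near `(e, x₀)` and `e` acts trivially near `x₀`. -/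
structure IsLocalAction (F : Z × E → E) (e : Z) (x₀ : E) : Prop where
  contDiffAt : ContDiffAt ℝ 3 F (e, x₀)
  one_act : ∀ᶠ y in 𝓝 x₀, F (e, y) = y

namespace IsLocalAction

variable {F : Z × E → E} {e : Z} {x₀ : E}

theorem eventually_contDiffAt (A : IsLocalAction F e x₀) :
    ∀ᶠ y in 𝓝 x₀, ContDiffAt ℝ 3 F (e, y) := by
  have h1 := A.contDiffAt.eventually (by norm_cast)
  have h2 : Tendsto (fun y : E => (e, y)) (𝓝 x₀) (𝓝 (e, x₀)) :=
    (Continuous.prodMk_right e).tendsto x₀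
  exact h2.eventually h1

theorem fderiv_one (A : IsLocalAction F e x₀) :
    ∀ᶠ y in 𝓝 x₀, ∀ v, fderiv ℝ F (e, y) (0, v) = v := by
  filter_upwards [A.eventually_contDiffAt, A.one_act.eventually_nhds] with y hc h1 v
  have hF := (hc.differentiableAt (by norm_num)).hasFDerivAt
  have h2 : HasFDerivAt (fun y' : E => F (e, y'))
      ((fderiv ℝ F (e, y)).comp (ContinuousLinearMap.inr ℝ Z E)) y :=
    hF.comp y (hasFDerivAt_prodMk_right e y)
  have h3 : HasFDerivAt (fun y' : E => F (e, y')) (ContinuousLinearMap.id ℝ E) y :=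
    (hasFDerivAt_id y).congr_of_eventuallyEq h1
  simpa using DFunLike.congr_fun (h2.unique h3) v

theorem contDiffAt_fundField (A : IsLocalAction F e x₀) (X : Z) :
    ContDiffAt ℝ 2 (fundField F e X) x₀ := by
  have h1 : ContDiffAt ℝ 2 (fderiv ℝ F) (e, x₀) := A.contDiffAt.fderiv_right (by norm_num)
  exact (h1.comp x₀ (contDiff_prodMk_right e).contDiffAt).clm_apply contDiffAt_const

/-- Second derivatives in mixed directions of the action are first derivatives of fundamental
fields. -/
theorem fderiv_fundField (A : IsLocalAction F e x₀) :
    ∀ᶠ y in 𝓝 x₀, ∀ X v,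
      fderiv ℝ (fundField F e X) y v = fderiv ℝ (fderiv ℝ F) (e, y) (X, 0) (0, v) ∧
      fderiv ℝ (fundField F e X) y v = fderiv ℝ (fderiv ℝ F) (e, y) (0, v) (X, 0) := by
  filter_upwards [A.eventually_contDiffAt] with y hc X v
  have hd := ((hc.of_le (by norm_num)).differentiableAt_fderiv).hasFDerivAt
  have h2 : HasFDerivAt (fun y' : E => fderiv ℝ F (e, y'))
      ((fderiv ℝ (fderiv ℝ F) (e, y)).comp (ContinuousLinearMap.inr ℝ Z E)) y :=
    hd.comp y (hasFDerivAt_prodMk_right e y)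
  have h3 : fderiv ℝ (fundField F e X) y v = fderiv ℝ (fderiv ℝ F) (e, y) (0, v) (X, 0) := by
    unfold fundField
    rw [(h2.clm_apply (hasFDerivAt_const (X, (0 : E)) y)).fderiv]
    simp
  refine ⟨?_, h3⟩
  rw [h3]
  exact (hc.isSymmSndFDerivAt (by simp; norm_num)) _ _

/-- The fundamental fields of an action by isometries are Killing fields. -/
theorem isLocalKilling (A : IsLocalAction F e x₀) {h : E → E →L[ℝ] E →L[ℝ] ℝ}
    (H : IsLocalMetric h x₀)
    (hinv : ∀ᶠ p in 𝓝 (e, x₀), ∀ v w,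
      h (F p) (fderiv ℝ F p (0, v)) (fderiv ℝ F p (0, w)) = h p.2 v w) (X : Z) :
    IsLocalKilling h x₀ (fundField F e X) := by
  refine ⟨A.contDiffAt_fundField X, ?_⟩
  have h2 : Tendsto (fun y : E => (e, y)) (𝓝 x₀) (𝓝 (e, x₀)) :=
    (Continuous.prodMk_right e).tendsto x₀
  filter_upwards [A.eventually_contDiffAt, A.one_act, A.fderiv_one, A.fderiv_fundField,
    h2.eventually hinv.eventually_nhds, H.contDiffAt.eventually (by norm_cast)]
    with y hc h1 hid hf hi hh v w
  have dF := hc.differentiableAt (by norm_num)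
  have dF' := (hc.of_le (m := 2) (by norm_num)).differentiableAt_fderiv
  have dh := hh.differentiableAt (by norm_num)
  have dh1 : DifferentiableAt ℝ h (F (e, y)) := by rwa [h1]
  have dv : ∀ v : E, DifferentiableAt ℝ (fun p => fderiv ℝ F p ((0 : Z), v)) (e, y) := fun v =>
    dF'.clm_apply (differentiableAt_const _)
  have hv : ∀ v : E, fderiv ℝ (fun p => fderiv ℝ F p ((0 : Z), v)) (e, y) (X, 0) =
      fderiv ℝ (fundField F e X) y v := by
    intro v
    rw [fderiv_clm_apply dF' (differentiableAt_const _), (hf X v).1]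
    simp
  have e1 : (fun p : Z × E => h (F p) (fderiv ℝ F p (0, v)) (fderiv ℝ F p (0, w)))
      =ᶠ[𝓝 (e, y)] fun p => h p.2 v w := hi.mono fun p hp => hp v w
  have e2 := DFunLike.congr_fun (EventuallyEq.fderiv_eq (𝕜 := ℝ) e1) (X, 0)
  have c1 : fderiv ℝ (fun p => h (F p)) (e, y) (X, 0) = fderiv ℝ h y (fundField F e X y) := by
    have := (dh1.hasFDerivAt.comp (e, y) dF.hasFDerivAt).fderiv
    have h3 : fderiv ℝ (fun p => h (F p)) (e, y) = _ := this
    rw [h3, h1]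
    rfl
  have c2 : fderiv ℝ (fun p : Z × E => h p.2) (e, y) (X, 0) = 0 := by
    have h3 : fderiv ℝ (fun p : Z × E => h p.2) (e, y) = _ :=
      (HasFDerivAt.comp (e, y) (f := Prod.snd) (g := h) dh.hasFDerivAt hasFDerivAt_snd).fderiv
    rw [h3]
    simp
  rw [fderiv_clm_apply₂ (f := fun p => h (F p)) (dh1.comp (e, y) dF) (dv v) (dv w),
    fderiv_clm_apply₂ (f := fun p : Z × E => h p.2) (a := fun _ => v) (b := fun _ => w)
      (DifferentiableAt.comp (e, y) (f := Prod.snd) (g := h) dh differentiableAt_snd)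
      (differentiableAt_const _) (differentiableAt_const _), hv, hv, c1, c2] at e2
  simpa [hid, h1] using e2

/-- If the elements `z` near `e` transform the fundamental field of `Y` into that of `a z`, then
the bracket of the fundamental fields of `X` and `Y` is given by the derivative of `a`. -/
theorem fundField_bracket (A : IsLocalAction F e x₀) {Y : Z} {a : Z → Z} {L : Z →L[ℝ] Z}
    (ha : HasFDerivAt a L e) (hae : a e = Y)
    (hequi : ∀ᶠ p in 𝓝 (e, x₀),
      fderiv ℝ F p (0, fundField F e Y p.2) = fundField F e (a p.1) (F p)) (X : Z) :
    ∀ᶠ y in 𝓝 x₀,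
      fderiv ℝ (fundField F e X) y (fundField F e Y y)
        - fderiv ℝ (fundField F e Y) y (fundField F e X y) = fundField F e (L X) y := by
  have h2 : Tendsto (fun y : E => (e, y)) (𝓝 x₀) (𝓝 (e, x₀)) :=
    (Continuous.prodMk_right e).tendsto x₀
  filter_upwards [A.eventually_contDiffAt, A.one_act, A.fderiv_fundField,
    h2.eventually hequi.eventually_nhds] with y hc h1 hf hi
  have dF := hc.differentiableAt (by norm_num)
  have dF' := (hc.of_le (m := 2) (by norm_num)).differentiableAt_fderiv
  have dF1' : DifferentiableAt ℝ (fderiv ℝ F) (e, F (e, y)) := by rwa [h1]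
  have e2 := DFunLike.congr_fun (EventuallyEq.fderiv_eq (𝕜 := ℝ) hi) (X, 0)
  -- the left-hand side
  have dV : HasFDerivAt (fun p : Z × E => fundField F e Y p.2)
      ((fderiv ℝ (fundField F e Y) y).comp (ContinuousLinearMap.snd ℝ Z E)) (e, y) := by
    have h3 : DifferentiableAt ℝ (fundField F e Y) y := by
      have := dF'.comp y (f := fun y' : E => (e, y')) (hasFDerivAt_prodMk_right e y).differentiableAt
      exact this.clm_apply (differentiableAt_const _)
    exact HasFDerivAt.comp (e, y) (f := Prod.snd) (g := fundField F e Y) h3.hasFDerivAt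
      hasFDerivAt_snd
  have c1 := (dF'.hasFDerivAt.clm_apply ((hasFDerivAt_const (0 : Z) (e, y)).prodMk dV)).fderiv
  -- the right-hand side
  have dI : HasFDerivAt (fun p : Z × E => fderiv ℝ F (e, F p))
      ((fderiv ℝ (fderiv ℝ F) (e, y)).comp ((ContinuousLinearMap.inr ℝ Z E).comp
        (fderiv ℝ F (e, y)))) (e, y) := by
    have h3 := dF1'.hasFDerivAt
    have h4 : HasFDerivAt (fun p : Z × E => (e, F p))
      ((ContinuousLinearMap.inr ℝ Z E).comp (fderiv ℝ F (e, y))) (e, y) :=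
      (hasFDerivAt_prodMk_right e (F (e, y))).comp (e, y) dF.hasFDerivAt
    have h5 := HasFDerivAt.comp (e, y) h3 h4
    rw [h1] at h5
    exact h5
  have da : HasFDerivAt (fun p : Z × E => a p.1) (L.comp (ContinuousLinearMap.fst ℝ Z E)) (e, y) :=
    HasFDerivAt.comp (e, y) (f := Prod.fst) (g := a) ha hasFDerivAt_fst
  have c2 := (dI.clm_apply (da.prodMk (hasFDerivAt_const (0 : E) (e, y)))).fderiv
  rw [c1] at e2
  simp only [fundField] at e2 ⊢
  rw [c2] at e2
  have f1 := (hf X (fundField F e Y y)).1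
  have f2 := (hf Y (fundField F e X y)).2
  simp only [fundField] at f1 f2
  rw [f1, f2]
  simp only [add_apply, ContinuousLinearMap.comp_apply, ContinuousLinearMap.flip_apply,
    ContinuousLinearMap.prod_apply, zero_apply, ContinuousLinearMap.coe_snd',
    ContinuousLinearMap.coe_fst', ContinuousLinearMap.inr_apply, map_zero, Prod.mk_zero_zero,
    zero_add, hae, h1] at e2
  rw [e2]
  abel

/-- The derivative at the neutral element `e` of the adjoint action of a group whose
multiplication and conjugation are, in a chart, `F` and `C`. -/
theorem hasFDerivAt_conj {F C : Z × Z → Z} {e : Z} (A : IsLocalAction F e e)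
    (hr : ∀ᶠ z in 𝓝 e, F (z, e) = z)
    (hC : ContDiffAt ℝ 3 C (e, e)) (hC1 : ∀ᶠ y in 𝓝 e, C (e, y) = y) (hCe : ∀ᶠ z in 𝓝 e, C (z, e) = e)
    (hFC : ∀ᶠ p in 𝓝 (e, e), F (C p, p.1) = F p) (Y : Z) :
    ∃ L : Z →L[ℝ] Z, HasFDerivAt (fun z => fderiv ℝ C (z, e) (0, Y)) L e ∧
      ∀ X, L X = fderiv ℝ (fderiv ℝ F) (e, e) (X, 0) (0, Y)
        - fderiv ℝ (fderiv ℝ F) (e, e) (Y, 0) (0, X) := by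
  have h2 : Tendsto (fun z : Z => (z, e)) (𝓝 e) (𝓝 (e, e)) :=
    (Continuous.prodMk_left e).tendsto e
  have dC' := (hC.of_le (m := 2) (by norm_num)).differentiableAt_fderiv
  have dF' := (A.contDiffAt.of_le (m := 2) (by norm_num)).differentiableAt_fderiv
  have dF := A.contDiffAt.differentiableAt (by norm_num)
  have d1 : DifferentiableAt ℝ (fun z => fderiv ℝ C (z, e) (0, Y)) e :=
    (dC'.comp e (f := fun z : Z => (z, e)) (hasFDerivAt_prodMk_left e e).differentiableAt).clm_apply
      (differentiableAt_const _)
  refine ⟨_, d1.hasFDerivAt, fun X => ?_⟩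
  -- `R_z (Ad z Y) = L_z Y`
  have key : (fun z => fderiv ℝ F (e, z) (fderiv ℝ C (z, e) (0, Y), 0)) =ᶠ[𝓝 e]
      fun z => fderiv ℝ F (z, e) (0, Y) := by
    filter_upwards [h2.eventually (hC.eventually (by norm_cast)), hCe,
      h2.eventually (A.contDiffAt.eventually (by norm_cast)), A.eventually_contDiffAt,
      h2.eventually hFC.eventually_nhds] with z c1 c2 c3 c4 c5
    have dC1 := (c1.differentiableAt (by norm_num)).hasFDerivAt
    have dF1 := (c3.differentiableAt (by norm_num)).hasFDerivAt
    have dF2 : HasFDerivAt F (fderiv ℝ F (e, z)) (C (z, e), z) := by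
      rw [c2]
      exact (c4.differentiableAt (by norm_num)).hasFDerivAt
    have t := HasFDerivAt.comp (z, e) dF2 (dC1.prodMk hasFDerivAt_fst)
    have e2 := DFunLike.congr_fun (EventuallyEq.fderiv_eq (𝕜 := ℝ) c5) (0, Y)
    have t' : fderiv ℝ (fun p : Z × Z => F (C p, p.1)) (z, e) = _ := t.fderiv
    rw [t'] at e2
    simpa using e2
  have e2 := DFunLike.congr_fun (EventuallyEq.fderiv_eq (𝕜 := ℝ) key) X
  have i1 : HasFDerivAt (fun z : Z => fderiv ℝ F (e, z))
      ((fderiv ℝ (fderiv ℝ F) (e, e)).comp (ContinuousLinearMap.inr ℝ Z Z)) e :=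
    dF'.hasFDerivAt.comp e (hasFDerivAt_prodMk_right e e)
  have i2 : HasFDerivAt (fun z : Z => fderiv ℝ F (z, e))
      ((fderiv ℝ (fderiv ℝ F) (e, e)).comp (ContinuousLinearMap.inl ℝ Z Z)) e :=
    HasFDerivAt.comp e (f := fun z : Z => (z, e)) dF'.hasFDerivAt (hasFDerivAt_prodMk_left e e)
  have j1 := (i1.clm_apply (d1.hasFDerivAt.prodMk (hasFDerivAt_const (0 : Z) e))).fderiv
  have j2 := (i2.clm_apply (hasFDerivAt_const ((0 : Z), Y) e)).fderiv
  rw [j1, j2] at e2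
  have hYe : fderiv ℝ C (e, e) (0, Y) = Y :=
    (IsLocalAction.fderiv_one ⟨hC, hC1⟩).self_of_nhds Y
  have hl : ∀ W, fderiv ℝ F (e, e) (W, 0) = W := by
    intro W
    have h3 : HasFDerivAt (fun z : Z => F (z, e))
        ((fderiv ℝ F (e, e)).comp (ContinuousLinearMap.inl ℝ Z Z)) e :=
      HasFDerivAt.comp e (f := fun z : Z => (z, e)) dF.hasFDerivAt (hasFDerivAt_prodMk_left e e)
    have h4 : HasFDerivAt (fun z : Z => F (z, e)) (ContinuousLinearMap.id ℝ Z) e :=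
      (hasFDerivAt_id e).congr_of_eventuallyEq hr
    simpa using DFunLike.congr_fun (h3.unique h4) W
  have s : fderiv ℝ (fderiv ℝ F) (e, e) (0, X) (Y, 0) =
      fderiv ℝ (fderiv ℝ F) (e, e) (Y, 0) (0, X) :=
    (A.contDiffAt.isSymmSndFDerivAt (by simp; norm_num)) _ _
  simp only [add_apply, ContinuousLinearMap.comp_apply, ContinuousLinearMap.flip_apply,
    ContinuousLinearMap.prod_apply, zero_apply, ContinuousLinearMap.inl_apply,
    ContinuousLinearMap.inr_apply, map_zero, zero_add, hYe, hl, s] at e2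
  rw [← e2]
  abel

end IsLocalAction

end LocalAction

/-! ### Derivatives in the preferred charts -/

section Charts

open Filter Topology

variable {E : Type*} [NormedAddCommGroup E] [NormedSpace ℝ E]
  {M : Type*} [TopologicalSpace M] [ChartedSpace E M]
  {E' : Type*} [NormedAddCommGroup E'] [NormedSpace ℝ E']
  {M' : Type*} [TopologicalSpace M'] [ChartedSpace E' M']
  {E'' : Type*} [NormedAddCommGroup E''] [NormedSpace ℝ E'']
  {M'' : Type*} [TopologicalSpace M''] [ChartedSpace E'' M'']

variable (E E') in
/-- The derivative of a map between manifolds, as a linear map between the model spaces, with which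
all tangent spaces are identified. -/
def dmap (f : M → M') (x : M) : E →L[ℝ] E' := mfderiv 𝓘(ℝ, E) 𝓘(ℝ, E') f x

theorem dmap_eq_fderiv (f : E → E') (x : E) : dmap E E' f x = fderiv ℝ f x :=
  mfderiv_eq_fderiv

theorem dmap_comp {g : M' → M''} {f : M → M'} {x : M}
    (hg : MDifferentiableAt 𝓘(ℝ, E') 𝓘(ℝ, E'') g (f x))
    (hf : MDifferentiableAt 𝓘(ℝ, E) 𝓘(ℝ, E') f x) :
    dmap E E'' (fun y => g (f y)) x = (dmap E' E'' g (f x)).comp (dmap E E' f x) :=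
  mfderiv_comp x hg hf

theorem dmap_congr {f g : M → M'} {x : M} (h : f =ᶠ[𝓝 x] g) : dmap E E' f x = dmap E E' g x :=
  h.mfderiv_eq

theorem dmap_id (x : M) : dmap E E (fun y : M => y) x = ContinuousLinearMap.id ℝ E :=
  mfderiv_id

theorem dmap_extChartAt_self [IsManifold 𝓘(ℝ, E) ∞ M] (p : M) :
    dmap E E (extChartAt 𝓘(ℝ, E) p) p = ContinuousLinearMap.id ℝ E := by
  have : IsManifold 𝓘(ℝ, E) 1 M := IsManifold.of_le (n := ∞) (by norm_cast)
  exact mfderiv_extChartAt_self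

theorem target_mem_nhds (p : M) : ∀ᶠ y in 𝓝 (extChartAt 𝓘(ℝ, E) p p),
    y ∈ (extChartAt 𝓘(ℝ, E) p).target :=
  (isOpen_extChartAt_target p).mem_nhds (mem_extChartAt_target p)

variable [IsManifold 𝓘(ℝ, E) ∞ M]

theorem contMDiffAt_chart {p q : M} (hq : q ∈ (extChartAt 𝓘(ℝ, E) p).source) :
    ContMDiffAt 𝓘(ℝ, E) 𝓘(ℝ, E) ∞ (extChartAt 𝓘(ℝ, E) p) q :=
  contMDiffAt_extChartAt' (by simpa using hq)

theorem contMDiffAt_chart_symm {p : M} {y : E} (hy : y ∈ (extChartAt 𝓘(ℝ, E) p).target) :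
    ContMDiffAt 𝓘(ℝ, E) 𝓘(ℝ, E) ∞ (extChartAt 𝓘(ℝ, E) p).symm y :=
  (contMDiffOn_extChartAt_symm p).contMDiffAt ((isOpen_extChartAt_target p).mem_nhds hy)

theorem mdifferentiableAt_chart {p q : M} (hq : q ∈ (extChartAt 𝓘(ℝ, E) p).source) :
    MDifferentiableAt 𝓘(ℝ, E) 𝓘(ℝ, E) (extChartAt 𝓘(ℝ, E) p) q :=
  (contMDiffAt_chart hq).mdifferentiableAt (by simp)

theorem mdifferentiableAt_chart_symm {p : M} {y : E} (hy : y ∈ (extChartAt 𝓘(ℝ, E) p).target) :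
    MDifferentiableAt 𝓘(ℝ, E) 𝓘(ℝ, E) (extChartAt 𝓘(ℝ, E) p).symm y :=
  (contMDiffAt_chart_symm hy).mdifferentiableAt (by simp)

theorem dmap_symm_dmap {p q : M} (hq : q ∈ (extChartAt 𝓘(ℝ, E) p).source) (v : E) :
    dmap E E (extChartAt 𝓘(ℝ, E) p).symm (extChartAt 𝓘(ℝ, E) p q)
      (dmap E E (extChartAt 𝓘(ℝ, E) p) q v) = v := by
  have h1 := dmap_comp (mdifferentiableAt_chart_symm ((extChartAt 𝓘(ℝ, E) p).map_source hq))
    (mdifferentiableAt_chart hq)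
  have h2 : (fun q' => (extChartAt 𝓘(ℝ, E) p).symm (extChartAt 𝓘(ℝ, E) p q')) =ᶠ[𝓝 q]
      fun q' => q' := by
    filter_upwards [(isOpen_extChartAt_source p).mem_nhds hq] with q' hq'
    exact (extChartAt 𝓘(ℝ, E) p).left_inv hq'
  rw [dmap_congr h2, dmap_id] at h1
  exact (DFunLike.congr_fun h1 v).symm

theorem dmap_dmap_symm {p : M} {y : E} (hy : y ∈ (extChartAt 𝓘(ℝ, E) p).target) (v : E) :
    dmap E E (extChartAt 𝓘(ℝ, E) p) ((extChartAt 𝓘(ℝ, E) p).symm y)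
      (dmap E E (extChartAt 𝓘(ℝ, E) p).symm y v) = v := by
  have h1 := dmap_comp (mdifferentiableAt_chart ((extChartAt 𝓘(ℝ, E) p).map_target hy))
    (mdifferentiableAt_chart_symm hy)
  have h2 : (fun y' => (extChartAt 𝓘(ℝ, E) p ((extChartAt 𝓘(ℝ, E) p).symm y'))) =ᶠ[𝓝 y]
      fun y' => y' := by
    filter_upwards [(isOpen_extChartAt_target p).mem_nhds hy] with q' hq'
    exact (extChartAt 𝓘(ℝ, E) p).right_inv hq'
  rw [dmap_congr h2, dmap_id] at h1
  exact (DFunLike.congr_fun h1 v).symm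

theorem dmap_chart_symm_self (p : M) :
    dmap E E (extChartAt 𝓘(ℝ, E) p).symm (extChartAt 𝓘(ℝ, E) p p) = ContinuousLinearMap.id ℝ E := by
  ext v
  have h := dmap_symm_dmap (mem_extChartAt_source (I := 𝓘(ℝ, E)) p) v
  rwa [dmap_extChartAt_self] at h

section Metric

/-- The inner product of a metric at `q`, on the model space. -/
def innerAt (g : Metric E M) (q : M) : E →L[ℝ] E →L[ℝ] ℝ := g.inner q

theorem chartMetric_eq (g : Metric E M) (p : M) (y v w : E) :
    chartMetric g p y v w = innerAt g ((extChartAt 𝓘(ℝ, E) p).symm y)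
      (dmap E E (extChartAt 𝓘(ℝ, E) p).symm y v) (dmap E E (extChartAt 𝓘(ℝ, E) p).symm y w) := rfl

theorem chartMetric_dmap (g : Metric E M) {p q : M} (hq : q ∈ (extChartAt 𝓘(ℝ, E) p).source)
    (v w : E) :
    chartMetric g p (extChartAt 𝓘(ℝ, E) p q) (dmap E E (extChartAt 𝓘(ℝ, E) p) q v)
      (dmap E E (extChartAt 𝓘(ℝ, E) p) q w) = innerAt g q v w := by
  rw [chartMetric_eq, dmap_symm_dmap hq, dmap_symm_dmap hq, (extChartAt 𝓘(ℝ, E) p).left_inv hq]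

theorem chartMetric_self (g : Metric E M) (p : M) (v w : E) :
    chartMetric g p (extChartAt 𝓘(ℝ, E) p p) v w = innerAt g p v w := by
  have := chartMetric_dmap g (mem_extChartAt_source (I := 𝓘(ℝ, E)) p) v w
  rwa [dmap_extChartAt_self] at this

theorem innerAt_pos (g : Metric E M) (q : M) (v : E) (hv : v ≠ 0) : 0 < innerAt g q v v :=
  g.pos q v hv

theorem innerAt_symm (g : Metric E M) (q : M) (v w : E) : innerAt g q v w = innerAt g q w v :=
  g.symm q v w

variable [FiniteDimensional ℝ E]

theorem contDiffAt_of_forall_apply {F D : Type*} [NormedAddCommGroup F] [NormedSpace ℝ F]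
    [NormedAddCommGroup D] [NormedSpace ℝ D] {n : WithTop ℕ∞} {f : D → E →L[ℝ] F} {x : D}
    (h : ∀ v, ContDiffAt ℝ n (fun y => f y v) x) : ContDiffAt ℝ n f x := by
  have hd : Module.finrank ℝ E = Module.finrank ℝ (Fin (Module.finrank ℝ E) → ℝ) := by simp
  let e₁ := ContinuousLinearEquiv.ofFinrankEq hd
  let e₂ := (e₁.arrowCongr (1 : F ≃L[ℝ] F)).trans (ContinuousLinearEquiv.piRing (Fin _))
  rw [← Function.id_comp f, ← e₂.symm_comp_self]
  exact e₂.symm.contDiff.contDiffAt.comp x (contDiffAt_pi.mpr fun i => h _)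

theorem contDiffAt_chartMetric (g : Metric E M) (p : M) :
    ContDiffAt ℝ 2 (chartMetric g p) (extChartAt 𝓘(ℝ, E) p p) := by
  have hp : (extChartAt 𝓘(ℝ, E) p).symm (extChartAt 𝓘(ℝ, E) p p) = p := extChartAt_to_inv p
  have hb : ContMDiffAt 𝓘(ℝ, E) 𝓘(ℝ, E) 2 (extChartAt 𝓘(ℝ, E) p).symm (extChartAt 𝓘(ℝ, E) p p) :=
    (contMDiffAt_chart_symm (mem_extChartAt_target p)).of_le (by norm_cast)
  -- in the trivialization at `p`, the coordinate fields of the chart are constant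
  have hsec : ∀ v : E, ContMDiffAt 𝓘(ℝ, E) (𝓘(ℝ, E).prod 𝓘(ℝ, E)) 2
      (fun y => Bundle.TotalSpace.mk' E (E := fun x : M => TangentSpace 𝓘(ℝ, E) x)
        ((extChartAt 𝓘(ℝ, E) p).symm y)
        (mfderiv 𝓘(ℝ, E) 𝓘(ℝ, E) (extChartAt 𝓘(ℝ, E) p).symm y v)) (extChartAt 𝓘(ℝ, E) p p) := by
    intro v
    rw [Bundle.contMDiffAt_totalSpace]
    refine ⟨hb, ?_⟩
    refine (contMDiffAt_const (c := v)).congr_of_eventuallyEq ?_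
    filter_upwards [target_mem_nhds p] with y hy
    have hq := (extChartAt 𝓘(ℝ, E) p).map_target hy
    rw [extChartAt_source] at hq
    have : IsManifold 𝓘(ℝ, E) 1 M := IsManifold.of_le (n := ∞) (by norm_cast)
    have h1 := TangentBundle.continuousLinearMapAt_trivializationAt (I := 𝓘(ℝ, E)) hq
    have h2 := dmap_dmap_symm hy v
    simp only [hp]
    have h3 : (trivializationAt E (TangentSpace 𝓘(ℝ, E)) p).continuousLinearMapAt ℝ
        ((extChartAt 𝓘(ℝ, E) p).symm y)
        (mfderiv 𝓘(ℝ, E) 𝓘(ℝ, E) (extChartAt 𝓘(ℝ, E) p).symm y v) = v := by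
      rw [h1]
      exact h2
    rw [Bundle.Trivialization.continuousLinearMapAt_apply,
      Bundle.Trivialization.coe_linearMapAt_of_mem _ (by simpa using hq)] at h3
    exact h3
  have hpt : ∀ v w, ContDiffAt ℝ 2 (fun y => chartMetric g p y v w) (extChartAt 𝓘(ℝ, E) p p) := by
    intro v w
    rw [← contMDiffAt_iff_contDiffAt]
    have hg : ContMDiff 𝓘(ℝ, E) (𝓘(ℝ, E).prod 𝓘(ℝ, E →L[ℝ] E →L[ℝ] ℝ)) 2
      (fun b => Bundle.TotalSpace.mk' (E →L[ℝ] E →L[ℝ] ℝ) b (g.inner b)) :=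
      g.contMDiff.of_le (by norm_cast)
    have h1 := ContMDiffAt.clm_bundle_apply₂
      (b := (extChartAt 𝓘(ℝ, E) p).symm) (IM := 𝓘(ℝ, E)) (IB := 𝓘(ℝ, E)) (n := 2)
      (E₁ := fun x : M => TangentSpace 𝓘(ℝ, E) x) (E₂ := fun x : M => TangentSpace 𝓘(ℝ, E) x)
      (E₃ := Bundle.Trivial M ℝ) (F₁ := E) (F₂ := E) (F₃ := ℝ)
      (ψ := fun y => g.inner ((extChartAt 𝓘(ℝ, E) p).symm y)) (x := extChartAt 𝓘(ℝ, E) p p)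
      (ContMDiffAt.comp _ hg.contMDiffAt hb) (hsec v) (hsec w)
    rw [Bundle.contMDiffAt_totalSpace] at h1
    exact h1.2
  exact contDiffAt_of_forall_apply fun v => contDiffAt_of_forall_apply fun w => hpt v w

theorem isLocalMetric_chartMetric (g : Metric E M) (p : M) :
    IsLocalMetric (chartMetric g p) (extChartAt 𝓘(ℝ, E) p p) where
  contDiffAt := contDiffAt_chartMetric g p
  symm := Eventually.of_forall fun y v w => by
    rw [chartMetric_eq, chartMetric_eq, innerAt_symm]
  pos := by
    filter_upwards [target_mem_nhds p] with y hy v hv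
    rw [chartMetric_eq]
    refine innerAt_pos g _ _ fun h0 => hv ?_
    rw [← dmap_dmap_symm hy v, h0, map_zero]

end Metric

end Charts

/-! ### Smooth actions in charts -/

section ActionChart

open Filter Topology

variable {EG : Type*} [NormedAddCommGroup EG] [NormedSpace ℝ EG]
  {G : Type*} [TopologicalSpace G] [ChartedSpace EG G] [Group G]
  {E : Type*} [NormedAddCommGroup E] [NormedSpace ℝ E]
  {M : Type*} [TopologicalSpace M] [ChartedSpace E M]
  {E' : Type*} [NormedAddCommGroup E'] [NormedSpace ℝ E']
  {N : Type*} [TopologicalSpace N] [ChartedSpace E' N]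

variable (EG G) in
/-- The coordinate vector of the neutral element. -/
def oneCoord : EG := extChartAt 𝓘(ℝ, EG) (1 : G) 1

variable (G) in
/-- The element of the group with coordinate vector `z`. -/
def ofCoord (z : EG) : G := (extChartAt 𝓘(ℝ, EG) (1 : G)).symm z

variable (EG E E') in
/-- A map `G × M → N`, read in the preferred charts at `1`, `p` and `r`. -/
def chartLift (f : G → M → N) (p : M) (r : N) (z : EG × E) : E' :=
  extChartAt 𝓘(ℝ, E') r (f (ofCoord G z.1) ((extChartAt 𝓘(ℝ, E) p).symm z.2))

theorem ofCoord_oneCoord : ofCoord G (oneCoord EG G) = 1 := extChartAt_to_inv (1 : G)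

variable {f : G → M → N} {p : M} {r : N}

variable (EG E E') in
/-- The pairs of coordinate vectors at which `chartLift f p r` represents `f`. -/
def chartLiftDomain (f : G → M → N) (p : M) (r : N) : Set (EG × E) :=
  {z | z.1 ∈ (extChartAt 𝓘(ℝ, EG) (1 : G)).target ∧ z.2 ∈ (extChartAt 𝓘(ℝ, E) p).target ∧
    f (ofCoord G z.1) ((extChartAt 𝓘(ℝ, E) p).symm z.2) ∈ (extChartAt 𝓘(ℝ, E') r).source}

theorem mdifferentiableAt_left
    (hf : ContMDiff (𝓘(ℝ, EG).prod 𝓘(ℝ, E)) 𝓘(ℝ, E') ∞ (fun x : G × M => f x.1 x.2))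
    (a : G) (q : M) :
    MDifferentiableAt 𝓘(ℝ, EG) 𝓘(ℝ, E') (fun b => f b q) a :=
  (ContMDiffAt.comp a hf.contMDiffAt (contMDiffAt_id.prodMk contMDiffAt_const)).mdifferentiableAt
    (by simp)

theorem mdifferentiableAt_right
    (hf : ContMDiff (𝓘(ℝ, EG).prod 𝓘(ℝ, E)) 𝓘(ℝ, E') ∞ (fun x : G × M => f x.1 x.2))
    (a : G) (q : M) :
    MDifferentiableAt 𝓘(ℝ, E) 𝓘(ℝ, E') (f a) q :=
  (ContMDiffAt.comp q hf.contMDiffAt (contMDiffAt_const.prodMk contMDiffAt_id)).mdifferentiableAt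
    (by simp)

variable [IsManifold 𝓘(ℝ, EG) ∞ G] [IsManifold 𝓘(ℝ, E) ∞ M] [IsManifold 𝓘(ℝ, E') ∞ N]

theorem contMDiffAt_chartLift_pre
    (hf : ContMDiff (𝓘(ℝ, EG).prod 𝓘(ℝ, E)) 𝓘(ℝ, E') ∞ (fun x : G × M => f x.1 x.2))
    {z : EG × E} (hz : z ∈ chartLiftDomain EG E E' f p r) :
    ContMDiffAt 𝓘(ℝ, EG × E) 𝓘(ℝ, E') ∞
      (fun z : EG × E => f (ofCoord G z.1) ((extChartAt 𝓘(ℝ, E) p).symm z.2)) z := by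
  have h1 : ContMDiffAt 𝓘(ℝ, EG × E) 𝓘(ℝ, EG) ∞ (fun z : EG × E => ofCoord G z.1) z :=
    ContMDiffAt.comp z (contMDiffAt_chart_symm hz.1) contDiffAt_fst.contMDiffAt
  have h2 : ContMDiffAt 𝓘(ℝ, EG × E) 𝓘(ℝ, E) ∞
      (fun z : EG × E => (extChartAt 𝓘(ℝ, E) p).symm z.2) z :=
    ContMDiffAt.comp z (contMDiffAt_chart_symm hz.2.1) contDiffAt_snd.contMDiffAt
  exact ContMDiffAt.comp z hf.contMDiffAt (h1.prodMk h2)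

theorem contDiffAt_chartLift
    (hf : ContMDiff (𝓘(ℝ, EG).prod 𝓘(ℝ, E)) 𝓘(ℝ, E') ∞ (fun x : G × M => f x.1 x.2))
    {z : EG × E} (hz : z ∈ chartLiftDomain EG E E' f p r) :
    ContDiffAt ℝ 3 (chartLift EG E E' f p r) z := by
  have h : ContMDiffAt 𝓘(ℝ, EG × E) 𝓘(ℝ, E') ∞ (chartLift EG E E' f p r) z :=
    ContMDiffAt.comp z (contMDiffAt_chart hz.2.2) (contMDiffAt_chartLift_pre hf hz)
  exact (contMDiffAt_iff_contDiffAt.1 h).of_le (by norm_cast)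

theorem chartLiftDomain_mem_nhds
    (hf : ContMDiff (𝓘(ℝ, EG).prod 𝓘(ℝ, E)) 𝓘(ℝ, E') ∞ (fun x : G × M => f x.1 x.2))
    {z : EG × E} (hz : z ∈ chartLiftDomain EG E E' f p r) :
    ∀ᶠ z' in 𝓝 z, z' ∈ chartLiftDomain EG E E' f p r := by
  have h1 := (contMDiffAt_chartLift_pre hf hz).continuousAt
  filter_upwards [continuousAt_fst.eventually ((isOpen_extChartAt_target _).mem_nhds hz.1),
    continuousAt_snd.eventually ((isOpen_extChartAt_target _).mem_nhds hz.2.1),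
    h1.eventually ((isOpen_extChartAt_source _).mem_nhds hz.2.2)] with z' a b c
  exact ⟨a, b, c⟩

theorem fderiv_chartLift_left
    (hf : ContMDiff (𝓘(ℝ, EG).prod 𝓘(ℝ, E)) 𝓘(ℝ, E') ∞ (fun x : G × M => f x.1 x.2))
    {z : EG × E} (hz : z ∈ chartLiftDomain EG E E' f p r) (X : EG) :
    fderiv ℝ (chartLift EG E E' f p r) z (X, 0) =
      dmap E' E' (extChartAt 𝓘(ℝ, E') r)
        (f (ofCoord G z.1) ((extChartAt 𝓘(ℝ, E) p).symm z.2))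
        (dmap EG E' (fun a => f a ((extChartAt 𝓘(ℝ, E) p).symm z.2)) (ofCoord G z.1)
          (dmap EG EG (ofCoord G) z.1 X)) := by
  have h1 := ((contDiffAt_chartLift hf hz).differentiableAt (by norm_num)).hasFDerivAt
  have h2 := HasFDerivAt.comp z.1 (f := fun w => (w, z.2)) h1 (hasFDerivAt_prodMk_left z.1 z.2)
  have h3 := DFunLike.congr_fun h2.fderiv X
  rw [← dmap_eq_fderiv] at h3
  have d1 := mdifferentiableAt_chart_symm hz.1
  have d2 := mdifferentiableAt_left hf (ofCoord G z.1) ((extChartAt 𝓘(ℝ, E) p).symm z.2)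
  have h4 := dmap_comp (E := EG) (E' := E') (E'' := E') (x := z.1) (mdifferentiableAt_chart hz.2.2)
    (d2.comp z.1 d1)
  have h5 := dmap_comp (E := EG) (E' := EG) (E'' := E') (x := z.1) d2 d1
  have h6 : dmap EG E' (fun y => f (ofCoord G y) ((extChartAt 𝓘(ℝ, E) p).symm z.2)) z.1 = _ := h5
  have h7 : dmap EG E' (chartLift EG E E' f p r ∘ fun w => (w, z.2)) z.1 =
    (dmap E' E' (extChartAt 𝓘(ℝ, E') r) _).comp
    (dmap EG E' (fun y => f (ofCoord G y) ((extChartAt 𝓘(ℝ, E) p).symm z.2)) z.1) := h4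
  rw [h7, h6] at h3
  simpa using h3.symm

theorem fderiv_chartLift_right
    (hf : ContMDiff (𝓘(ℝ, EG).prod 𝓘(ℝ, E)) 𝓘(ℝ, E') ∞ (fun x : G × M => f x.1 x.2))
    {z : EG × E} (hz : z ∈ chartLiftDomain EG E E' f p r) (v : E) :
    fderiv ℝ (chartLift EG E E' f p r) z (0, v) =
      dmap E' E' (extChartAt 𝓘(ℝ, E') r)
        (f (ofCoord G z.1) ((extChartAt 𝓘(ℝ, E) p).symm z.2))
        (dmap E E' (f (ofCoord G z.1)) ((extChartAt 𝓘(ℝ, E) p).symm z.2)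
          (dmap E E (extChartAt 𝓘(ℝ, E) p).symm z.2 v)) := by
  have h1 := ((contDiffAt_chartLift hf hz).differentiableAt (by norm_num)).hasFDerivAt
  have h2 := HasFDerivAt.comp z.2 (f := fun w => (z.1, w)) h1 (hasFDerivAt_prodMk_right z.1 z.2)
  have h3 := DFunLike.congr_fun h2.fderiv v
  rw [← dmap_eq_fderiv] at h3
  have d1 := mdifferentiableAt_chart_symm hz.2.1
  have d2 := mdifferentiableAt_right hf (ofCoord G z.1) ((extChartAt 𝓘(ℝ, E) p).symm z.2)
  have h4 := dmap_comp (E := E) (E' := E') (E'' := E') (x := z.2) (mdifferentiableAt_chart hz.2.2)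
    (d2.comp z.2 d1)
  have h5 := dmap_comp (E := E) (E' := E) (E'' := E') (x := z.2) d2 d1
  have h7 : dmap E E' (chartLift EG E E' f p r ∘ fun w => (z.1, w)) z.2 =
    (dmap E' E' (extChartAt 𝓘(ℝ, E') r) _).comp
    (dmap E E' (fun y => f (ofCoord G z.1) ((extChartAt 𝓘(ℝ, E) p).symm y)) z.2) := h4
  rw [h7, h5] at h3
  simpa using h3.symm

end ActionChart

section LieGroup

open Filter Topology VectorField

variable {EG : Type*} [NormedAddCommGroup EG] [NormedSpace ℝ EG]
  {G : Type*} [TopologicalSpace G] [ChartedSpace EG G] [Group G]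

theorem oneCoord_mem : oneCoord EG G ∈ (extChartAt 𝓘(ℝ, EG) (1 : G)).target :=
  mem_extChartAt_target (I := 𝓘(ℝ, EG)) (1 : G)

theorem one_mem_chart_source : (1 : G) ∈ (extChartAt 𝓘(ℝ, EG) (1 : G)).source :=
  mem_extChartAt_source (I := 𝓘(ℝ, EG)) (1 : G)

variable [LieGroup 𝓘(ℝ, EG) ∞ G]

theorem contMDiff_conj : ContMDiff (𝓘(ℝ, EG).prod 𝓘(ℝ, EG)) 𝓘(ℝ, EG) ∞
    (fun x : G × G => x.1 * x.2 * x.1⁻¹) :=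
  (contMDiff_fst.mul contMDiff_snd).mul contMDiff_fst.inv

theorem dmap_ofCoord_oneCoord :
    dmap EG EG (ofCoord G) (oneCoord EG G) = ContinuousLinearMap.id ℝ EG :=
  dmap_chart_symm_self (1 : G)

theorem mpullbackWithin_chart_symm {E : Type*} [NormedAddCommGroup E] [NormedSpace ℝ E]
    {M : Type*} [TopologicalSpace M] [ChartedSpace E M] [IsManifold 𝓘(ℝ, E) ∞ M] {p : M} {y : E}
    (hy : y ∈ (extChartAt 𝓘(ℝ, E) p).target) (V : ∀ q : M, TangentSpace 𝓘(ℝ, E) q) :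
    mpullbackWithin 𝓘(ℝ, E) 𝓘(ℝ, E) (extChartAt 𝓘(ℝ, E) p).symm V (Set.range 𝓘(ℝ, E)) y =
      dmap E E (extChartAt 𝓘(ℝ, E) p) ((extChartAt 𝓘(ℝ, E) p).symm y)
        (V ((extChartAt 𝓘(ℝ, E) p).symm y)) := by
  have h1 : (dmap E E (extChartAt 𝓘(ℝ, E) p).symm y).inverse =
      dmap E E (extChartAt 𝓘(ℝ, E) p) ((extChartAt 𝓘(ℝ, E) p).symm y) := by
    refine ContinuousLinearMap.inverse_eq ?_ ?_
    · ext v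
      have := dmap_symm_dmap ((extChartAt 𝓘(ℝ, E) p).map_target hy) v
      rw [(extChartAt 𝓘(ℝ, E) p).right_inv hy] at this
      exact this
    · ext v
      exact dmap_dmap_symm hy v
  rw [mpullbackWithin_apply, ← h1, ModelWithCorners.range_eq_univ, mfderivWithin_univ]
  rfl

variable (EG G) in
/-- The action of a group on a manifold, read in the preferred charts at `1` and at `p`. -/
def actChart (E : Type*) [NormedAddCommGroup E] [NormedSpace ℝ E] {M : Type*} [TopologicalSpace M]
    [ChartedSpace E M] [MulAction G M] (p : M) : EG × E → E :=
  chartLift EG E E (fun (a : G) (q : M) => a • q) p p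

end LieGroup

/-! ### Fundamental fields of a smooth action -/

section SmoothAction

open Filter Topology VectorField

variable {EG : Type*} [NormedAddCommGroup EG] [NormedSpace ℝ EG]
  {G : Type*} [TopologicalSpace G] [ChartedSpace EG G] [Group G] [LieGroup 𝓘(ℝ, EG) ∞ G]
  {E : Type*} [NormedAddCommGroup E] [NormedSpace ℝ E]
  {M : Type*} [TopologicalSpace M] [ChartedSpace E M] [IsManifold 𝓘(ℝ, E) ∞ M]
  [MulAction G M] [ContMDiffSMul 𝓘(ℝ, EG) 𝓘(ℝ, E) ∞ G M]

theorem fundVec_eq (q : M) (X : LieAlg EG G) :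
    fundVec EG G E q X = dmap EG E (fun a : G => a • q) 1 X := rfl

theorem Ad_eq (a : G) (X : LieAlg EG G) :
    (Ad a X : EG) = dmap EG EG (fun x : G => a * x * a⁻¹) 1 X := rfl

theorem one_mem_actDomain {p : M} {y : E} (hy : y ∈ (extChartAt 𝓘(ℝ, E) p).target) :
    (oneCoord EG G, y) ∈ chartLiftDomain EG E E (fun (a : G) (q : M) => a • q) p p := by
  refine ⟨oneCoord_mem, hy, ?_⟩
  simp only [ofCoord_oneCoord, one_smul]
  exact (extChartAt 𝓘(ℝ, E) p).map_target hy

theorem actChart_one {p : M} {y : E} (hy : y ∈ (extChartAt 𝓘(ℝ, E) p).target) :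
    actChart EG G E p (oneCoord EG G, y) = y := by
  simp only [actChart, chartLift, ofCoord_oneCoord, one_smul]
  exact (extChartAt 𝓘(ℝ, E) p).right_inv hy

theorem isLocalAction_actChart (p : M) :
    IsLocalAction (actChart EG G E p) (oneCoord EG G) (extChartAt 𝓘(ℝ, E) p p) where
  contDiffAt := contDiffAt_chartLift contMDiff_smul (one_mem_actDomain (mem_extChartAt_target p))
  one_act := (target_mem_nhds p).mono fun _ hy => actChart_one hy

theorem mem_actDomain_nhds (p : M) : ∀ᶠ z in 𝓝 (oneCoord EG G, extChartAt 𝓘(ℝ, E) p p),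
    z ∈ chartLiftDomain EG E E (fun (a : G) (q : M) => a • q) p p :=
  chartLiftDomain_mem_nhds contMDiff_smul (one_mem_actDomain (mem_extChartAt_target p))

/-- In a chart, the fundamental fields are the fields `q ↦ X(q)`. -/
theorem fundField_actChart {p : M} {y : E} (hy : y ∈ (extChartAt 𝓘(ℝ, E) p).target)
    (X : LieAlg EG G) :
    fundField (actChart EG G E p) (oneCoord EG G) X y =
      dmap E E (extChartAt 𝓘(ℝ, E) p) ((extChartAt 𝓘(ℝ, E) p).symm y)
        (fundVec EG G E ((extChartAt 𝓘(ℝ, E) p).symm y) X) := by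
  have h := fderiv_chartLift_left (EG := EG) (f := fun (a : G) (q : M) => a • q) contMDiff_smul
    (one_mem_actDomain (EG := EG) (G := G) hy) X
  simp only [dmap_ofCoord_oneCoord, ofCoord_oneCoord, one_smul] at h
  exact h

theorem fundField_actChart_self (p : M) (X : LieAlg EG G) :
    fundField (actChart EG G E p) (oneCoord EG G) X (extChartAt 𝓘(ℝ, E) p p) =
      fundVec EG G E p X := by
  rw [fundField_actChart (mem_extChartAt_target p), extChartAt_to_inv, dmap_extChartAt_self]
  rfl

/-- The action transforms the fundamental field of `Y` into that of `Ad(a) Y`. -/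
theorem dmap_smul_fundVec (a : G) (q : M) (Y : LieAlg EG G) :
    dmap E E (fun x : M => a • x) q (fundVec EG G E q Y) = fundVec EG G E (a • q) (Ad a Y) := by
  have hs : ContMDiff (𝓘(ℝ, EG).prod 𝓘(ℝ, E)) 𝓘(ℝ, E) ∞ (fun x : G × M => x.1 • x.2) :=
    contMDiff_smul
  have h1 : MDifferentiableAt 𝓘(ℝ, E) 𝓘(ℝ, E) (fun x : M => a • x) ((1 : G) • q) :=
    mdifferentiableAt_right (EG := EG) (f := fun (a : G) (q : M) => a • q) hs a _
  have h2 : MDifferentiableAt 𝓘(ℝ, EG) 𝓘(ℝ, E) (fun b : G => b • q) 1 :=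
    mdifferentiableAt_left (f := fun (a : G) (q : M) => a • q) hs 1 q
  have h3 : MDifferentiableAt 𝓘(ℝ, EG) 𝓘(ℝ, E) (fun b : G => b • (a • q)) (a * 1 * a⁻¹) :=
    mdifferentiableAt_left (f := fun (a : G) (q : M) => a • q) hs _ _
  have h4 : MDifferentiableAt 𝓘(ℝ, EG) 𝓘(ℝ, EG) (fun x : G => a * x * a⁻¹) 1 :=
    mdifferentiableAt_right (EG := EG) (f := fun (a b : G) => a * b * a⁻¹) contMDiff_conj a 1
  have e1 := dmap_comp (f := fun b : G => b • q) (g := fun x : M => a • x) h1 h2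
  have e2 := dmap_comp (f := fun x : G => a * x * a⁻¹) (g := fun b : G => b • (a • q)) h3 h4
  have e3 : (fun b : G => a • b • q) = fun b : G => (a * b * a⁻¹) • a • q := by
    ext b
    simp [mul_smul]
  have e4 : a * 1 * a⁻¹ = 1 := by simp
  rw [e3, e2, one_smul, e4] at e1
  have := DFunLike.congr_fun e1 Y
  rw [fundVec_eq, fundVec_eq, Ad_eq]
  exact this.symm

theorem fundField_equivariant (p : M) (Y : LieAlg EG G) :
    ∀ᶠ z in 𝓝 (oneCoord EG G, extChartAt 𝓘(ℝ, E) p p),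
      fderiv ℝ (actChart EG G E p) z
        (0, fundField (actChart EG G E p) (oneCoord EG G) Y z.2) =
      fundField (actChart EG G E p) (oneCoord EG G) (Ad (ofCoord G z.1) Y)
        (actChart EG G E p z) := by
  filter_upwards [mem_actDomain_nhds p] with z hz
  have h1 := fderiv_chartLift_right (EG := EG) (E := E) (E' := E) (f := fun (a : G) (q : M) => a • q)
    contMDiff_smul hz
  have hF : (extChartAt 𝓘(ℝ, E) p).symm (actChart EG G E p z) =
      ofCoord G z.1 • (extChartAt 𝓘(ℝ, E) p).symm z.2 := (extChartAt 𝓘(ℝ, E) p).left_inv hz.2.2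
  have ht : actChart EG G E p z ∈ (extChartAt 𝓘(ℝ, E) p).target :=
    (extChartAt 𝓘(ℝ, E) p).map_source hz.2.2
  rw [fundField_actChart ht, hF, fundField_actChart hz.2.1, ← dmap_smul_fundVec, actChart, h1]
  have h2 := dmap_symm_dmap ((extChartAt 𝓘(ℝ, E) p).map_target hz.2.1)
    (fundVec EG G E ((extChartAt 𝓘(ℝ, E) p).symm z.2) Y)
  rw [(extChartAt 𝓘(ℝ, E) p).right_inv hz.2.1] at h2
  rw [h2]

/-! ### The derivative of the adjoint action -/

theorem fderiv_actChart_mul {y : EG} (hy : y ∈ (extChartAt 𝓘(ℝ, EG) (1 : G)).target) (Y : EG) :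
    fderiv ℝ (actChart EG G EG (1 : G)) (y, oneCoord EG G) (0, Y) =
      dmap EG EG (extChartAt 𝓘(ℝ, EG) (1 : G)) (ofCoord G y)
        (dmap EG EG (fun b : G => ofCoord G y * b) 1 Y) := by
  have hs : ofCoord G y ∈ (extChartAt 𝓘(ℝ, EG) (1 : G)).source :=
    (extChartAt 𝓘(ℝ, EG) (1 : G)).map_target hy
  have hone : (extChartAt 𝓘(ℝ, EG) (1 : G)).symm (oneCoord EG G) = 1 := ofCoord_oneCoord
  have hd : (y, oneCoord EG G) ∈ chartLiftDomain EG EG EG (fun a b : G => a • b) (1 : G) (1 : G) := by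
    refine ⟨hy, oneCoord_mem, ?_⟩
    rw [hone]
    simpa using hs
  have h2 : dmap EG EG (extChartAt 𝓘(ℝ, EG) (1 : G)).symm (oneCoord EG G) = _ :=
    dmap_ofCoord_oneCoord
  rw [actChart, fderiv_chartLift_right contMDiff_smul hd, h2]
  simp only [hone, smul_eq_mul, mul_one, ContinuousLinearMap.id_apply]
  rfl

theorem lieBracketWithin_eq_of_eventuallyEq {V W V' W' : E → E} {s : Set E} {x : E}
    (hs : s = Set.univ) (hV : V =ᶠ[𝓝 x] V') (hW : W =ᶠ[𝓝 x] W') :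
    lieBracketWithin ℝ V W s x = fderiv ℝ W' x (V' x) - fderiv ℝ V' x (W' x) := by
  rw [hs, lieBracketWithin_univ, hV.lieBracket_vectorField_eq hW, lieBracket_eq]

/-- The Lie bracket in terms of the second derivative of the multiplication in a chart. -/
theorem bracket_eq (X Y : LieAlg EG G) :
    (⁅X, Y⁆ : LieAlg EG G) =
      (fderiv ℝ (fderiv ℝ (actChart EG G EG (1 : G)))
        (oneCoord EG G, oneCoord EG G) ((X : EG), 0) (0, (Y : EG))
      - fderiv ℝ (fderiv ℝ (actChart EG G EG (1 : G)))
        (oneCoord EG G, oneCoord EG G) ((Y : EG), 0) (0, (X : EG)) : EG) := by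
  have : IsManifold 𝓘(ℝ, EG) 1 G := IsManifold.of_le (n := ∞) (by norm_cast)
  set F := actChart EG G EG (1 : G) with hF
  set e := oneCoord EG G with he
  have hdF : HasFDerivAt (fderiv ℝ F) (fderiv ℝ (fderiv ℝ F) (e, e)) (e, e) :=
    ((isLocalAction_actChart (EG := EG) (G := G) (E := EG) (1 : G)).contDiffAt.of_le
      (m := 2) (by norm_num)).differentiableAt_fderiv.hasFDerivAt
  -- the left invariant fields in the chart
  have hL : ∀ Y : LieAlg EG G, (mpullbackWithin 𝓘(ℝ, EG) 𝓘(ℝ, EG)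
      (extChartAt 𝓘(ℝ, EG) (1 : G)).symm (mulInvariantVectorField Y) (Set.range 𝓘(ℝ, EG)) : EG → EG)
      =ᶠ[𝓝 e] fun y => fderiv ℝ F (y, e) (0, (Y : EG)) := by
    intro Y
    filter_upwards [target_mem_nhds (1 : G)] with y hy
    exact (mpullbackWithin_chart_symm hy _).trans (fderiv_actChart_mul hy _).symm
  have hD : ∀ X Y : EG, fderiv ℝ (fun y => fderiv ℝ F (y, e) (0, Y)) e X =
      fderiv ℝ (fderiv ℝ F) (e, e) (X, 0) (0, Y) := by
    intro X Y
    have h1 := HasFDerivAt.comp e (f := fun y : EG => (y, e)) hdF (hasFDerivAt_prodMk_left e e)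
    have h2 := (h1.clm_apply (hasFDerivAt_const ((0 : EG), Y) e)).fderiv
    have h3 : fderiv ℝ (fun y => fderiv ℝ F (y, e) (0, Y)) e = _ := h2
    rw [h3]
    simp
  have hval : ∀ Y : EG, fderiv ℝ F (e, e) (0, Y) = Y :=
    (isLocalAction_actChart (EG := EG) (G := G) (E := EG) (1 : G)).fderiv_one.self_of_nhds
  have h0 : (dmap EG EG (extChartAt 𝓘(ℝ, EG) (1 : G)) (1 : G)).inverse =
      ContinuousLinearMap.id ℝ EG := by
    rw [dmap_extChartAt_self, ContinuousLinearMap.inverse_id]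
  have h1 : (⁅X, Y⁆ : LieAlg EG G) = (dmap EG EG (extChartAt 𝓘(ℝ, EG) (1 : G)) (1 : G)).inverse
      (lieBracketWithin ℝ
      (mpullbackWithin 𝓘(ℝ, EG) 𝓘(ℝ, EG) (extChartAt 𝓘(ℝ, EG) (1 : G)).symm
        (mulInvariantVectorField X) (Set.range 𝓘(ℝ, EG)))
      (mpullbackWithin 𝓘(ℝ, EG) 𝓘(ℝ, EG) (extChartAt 𝓘(ℝ, EG) (1 : G)).symm
        (mulInvariantVectorField Y) (Set.range 𝓘(ℝ, EG)))
      ((extChartAt 𝓘(ℝ, EG) (1 : G)).symm ⁻¹' Set.univ ∩ Set.range 𝓘(ℝ, EG)) e : EG) := by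
    rw [GroupLieAlgebra.bracket_def, mlieBracket, mlieBracketWithin_apply]
    rfl
  rw [h0, ContinuousLinearMap.id_apply] at h1
  refine h1.trans ((lieBracketWithin_eq_of_eventuallyEq (by simp) (hL X) (hL Y)).trans ?_)
  exact congrArg₂ (· - ·) ((congrArg _ (hval X)).trans (hD X Y))
    ((congrArg _ (hval Y)).trans (hD Y X))

/-- The derivative at `1` of `a ↦ Ad(a) Y` is `X ↦ [X, Y]`. -/
theorem exists_hasFDerivAt_Ad (Y : LieAlg EG G) :
    ∃ L : EG →L[ℝ] EG,
      HasFDerivAt (fun z : EG => (Ad (ofCoord G z) Y : EG)) L (oneCoord EG G) ∧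
      ∀ X : LieAlg EG G, (L X : EG) = (⁅X, Y⁆ : LieAlg EG G) := by
  set C : EG × EG → EG := chartLift EG EG EG (fun a b : G => a * b * a⁻¹) (1 : G) (1 : G) with hC
  have hone : (extChartAt 𝓘(ℝ, EG) (1 : G)).symm (oneCoord EG G) = 1 := ofCoord_oneCoord
  have hdom : ∀ z ∈ (extChartAt 𝓘(ℝ, EG) (1 : G)).target, (z, oneCoord EG G) ∈
      chartLiftDomain EG EG EG (fun a b : G => a * b * a⁻¹) (1 : G) (1 : G) := by
    intro z hz
    refine ⟨hz, oneCoord_mem, ?_⟩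
    have h1 : ofCoord G z * 1 * (ofCoord G z)⁻¹ = 1 := by simp
    rw [hone]
    change ofCoord G z * 1 * (ofCoord G z)⁻¹ ∈ _
    rw [h1]
    exact one_mem_chart_source
  have ht : ∀ᶠ z in 𝓝 (oneCoord EG G), z ∈ (extChartAt 𝓘(ℝ, EG) (1 : G)).target :=
    target_mem_nhds (1 : G)
  obtain ⟨L, hL, hLX⟩ := IsLocalAction.hasFDerivAt_conj (e := oneCoord EG G)
    (F := actChart EG G EG (1 : G)) (C := C) (isLocalAction_actChart (1 : G))
    (by
      filter_upwards [ht] with z hz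
      simp only [actChart, chartLift, hone, smul_eq_mul, mul_one]
      exact (extChartAt 𝓘(ℝ, EG) (1 : G)).right_inv hz)
    (contDiffAt_chartLift contMDiff_conj (hdom _ oneCoord_mem))
    (by
      filter_upwards [ht] with z hz
      simp only [hC, chartLift, ofCoord_oneCoord, one_mul, inv_one, mul_one]
      exact (extChartAt 𝓘(ℝ, EG) (1 : G)).right_inv hz)
    (Eventually.of_forall fun z => by
      simp only [hC, chartLift, hone, mul_one, mul_inv_cancel]
      rfl)
    (by
      filter_upwards [chartLiftDomain_mem_nhds contMDiff_conj (hdom _ oneCoord_mem)] with z hz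
      have h1 : ofCoord G (C z) = _ := (extChartAt 𝓘(ℝ, EG) (1 : G)).left_inv hz.2.2
      simp only [actChart, chartLift, h1, smul_eq_mul]
      congr 1
      have h2 : (extChartAt 𝓘(ℝ, EG) (1 : G)).symm z.1 = ofCoord G z.1 := rfl
      rw [h2]
      simp) Y
  refine ⟨L, hL.congr_of_eventuallyEq ?_, fun X => ?_⟩
  · filter_upwards [ht] with z hz
    have h1 := fderiv_chartLift_right contMDiff_conj (hdom z hz) Y
    have h2 : dmap EG EG (extChartAt 𝓘(ℝ, EG) (1 : G)).symm (oneCoord EG G) = _ :=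
      dmap_ofCoord_oneCoord
    simp only [h2, hone, mul_one, mul_inv_cancel, dmap_extChartAt_self] at h1
    exact h1.symm
  · exact (hLX X).trans (bracket_eq X Y).symm

end SmoothAction

/-! ### Invariant metrics -/

section InvariantMetric

open Filter Topology

variable {EG : Type*} [NormedAddCommGroup EG] [NormedSpace ℝ EG] [FiniteDimensional ℝ EG]
  {G : Type*} [TopologicalSpace G] [ChartedSpace EG G] [Group G] [LieGroup 𝓘(ℝ, EG) ∞ G]
  {E : Type*} [NormedAddCommGroup E] [NormedSpace ℝ E]
  {M : Type*} [TopologicalSpace M] [ChartedSpace E M] [IsManifold 𝓘(ℝ, E) ∞ M]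
  [MulAction G M] [ContMDiffSMul 𝓘(ℝ, EG) 𝓘(ℝ, E) ∞ G M]

theorem Ad_one (X : LieAlg EG G) : Ad (1 : G) X = X := by
  have h : dmap EG EG (fun x : G => 1 * x * 1⁻¹) 1 = ContinuousLinearMap.id ℝ EG := by
    simp only [one_mul, inv_one, mul_one]
    exact dmap_id 1
  exact DFunLike.congr_fun h X

theorem fundField_bracket_actChart (p : M) (X Y : LieAlg EG G) :
    ∀ᶠ y in 𝓝 (extChartAt 𝓘(ℝ, E) p p),
      fderiv ℝ (fundField (actChart EG G E p) (oneCoord EG G) X) y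
          (fundField (actChart EG G E p) (oneCoord EG G) Y y)
        - fderiv ℝ (fundField (actChart EG G E p) (oneCoord EG G) Y) y
          (fundField (actChart EG G E p) (oneCoord EG G) X y)
        = fundField (actChart EG G E p) (oneCoord EG G)
          (⁅X, Y⁆ : LieAlg EG G) y := by
  obtain ⟨L, hL, hLX⟩ := exists_hasFDerivAt_Ad Y
  have hone : Ad (ofCoord G (oneCoord EG G)) Y = Y := by rw [ofCoord_oneCoord, Ad_one]
  have h := (isLocalAction_actChart (EG := EG) (G := G) (E := E) p).fundField_bracket hL hone
    (fundField_equivariant p Y) X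
  rw [← hLX X]
  exact h

theorem pulledBack_eq (g : Metric E M) (o : M) (X Y : LieAlg EG G) :
    pulledBack g o X Y = innerAt g o (fundVec EG G E o X) (fundVec EG G E o Y) := rfl

variable [FiniteDimensional ℝ E]

theorem isLocalKilling_fundField {g : Metric E M} (hg : IsInvariantMetric G g) (p : M)
    (X : LieAlg EG G) :
    IsLocalKilling (chartMetric g p) (extChartAt 𝓘(ℝ, E) p p)
      (fundField (actChart EG G E p) (oneCoord EG G) X) := by
  refine IsLocalAction.isLocalKilling (Z := EG) (isLocalAction_actChart (EG := EG) (G := G) p)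
    (isLocalMetric_chartMetric g p) ?_ X
  filter_upwards [mem_actDomain_nhds p] with z hz v w
  have h1 := fderiv_chartLift_right (EG := EG) (E := E) (E' := E)
    (f := fun (a : G) (q : M) => a • q) contMDiff_smul hz
  have h2 : actChart EG G E p z = extChartAt 𝓘(ℝ, E) p
    (ofCoord G z.1 • (extChartAt 𝓘(ℝ, E) p).symm z.2) := rfl
  have h3 := hg (ofCoord G z.1) ((extChartAt 𝓘(ℝ, E) p).symm z.2)
    (dmap E E (extChartAt 𝓘(ℝ, E) p).symm z.2 v) (dmap E E (extChartAt 𝓘(ℝ, E) p).symm z.2 w)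
  rw [h2, actChart, h1, h1, chartMetric_dmap g hz.2.2]
  exact h3

theorem isKillingFamily_fundField {g : Metric E M} (hg : IsInvariantMetric G g) {p : M}
    (hp : Function.Surjective (fundVec EG G E p)) :
    IsKillingFamily (chartMetric g p) (extChartAt 𝓘(ℝ, E) p p)
      (fun X : LieAlg EG G => fundField (actChart EG G E p) (oneCoord EG G) X) where
  killing X := isLocalKilling_fundField hg p X
  bracket X Y := fundField_bracket_actChart p X Y
  surjective v := by
    obtain ⟨Y, hY⟩ := hp v
    exact ⟨Y, (fundField_actChart_self p Y).trans hY⟩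

theorem ricci_fundVec (g : Metric E M) (p : M) (X : LieAlg EG G) :
    ricci g p (fundVec EG G E p X) (fundVec EG G E p X) =
      localRicci (chartMetric g p) (extChartAt 𝓘(ℝ, E) p p)
        (fundField (actChart EG G E p) (oneCoord EG G) X (extChartAt 𝓘(ℝ, E) p p))
        (fundField (actChart EG G E p) (oneCoord EG G) X (extChartAt 𝓘(ℝ, E) p p)) := by
  have h : dmap E E (extChartAt 𝓘(ℝ, E) p) p (fundVec EG G E p X) = fundVec EG G E p X := by
    rw [dmap_extChartAt_self]
    rfl
  have h1 : ricci g p (fundVec EG G E p X) (fundVec EG G E p X) =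
    localRicci (chartMetric g p) (extChartAt 𝓘(ℝ, E) p p)
      (dmap E E (extChartAt 𝓘(ℝ, E) p) p (fundVec EG G E p X))
      (dmap E E (extChartAt 𝓘(ℝ, E) p) p (fundVec EG G E p X)) := rfl
  rw [h1, h, fundField_actChart_self]

/-- Lower bound for the Ricci curvature of an invariant metric at `X(p)`, when the squared length of
the Killing field defined by `X` is critical at `p`, with negative semidefinite Hessian there. -/
theorem le_ricci {g : Metric E M} (hg : IsInvariantMetric G g) {p : M}
    (hp : Function.Surjective (fundVec EG G E p)) {X : LieAlg EG G}
    (hX : ∀ Y, pulledBack g p X ⁅X, Y⁆ = 0)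
    (hneg : ∀ Y, pulledBack g p ⁅X, Y⁆ ⁅X, Y⁆ + pulledBack g p X ⁅⁅X, Y⁆, Y⁆ ≤ 0)
    {n : ℕ} (Y : Fin n → LieAlg EG G)
    (hY : ∀ i j, pulledBack g p (Y i) (Y j) = if i = j then 1 else 0) :
    ∑ i, -(pulledBack g p ⁅X, Y i⁆ ⁅X, Y i⁆ + pulledBack g p X ⁅⁅X, Y i⁆, Y i⁆)
      + ∑ i, ∑ j, 1 / 4 * (pulledBack g p ⁅X, Y i⁆ (Y j) + pulledBack g p (Y i) ⁅Y j, X⁆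
        + pulledBack g p X ⁅Y j, Y i⁆) ^ 2
      ≤ ricci g p (fundVec EG G E p X) (fundVec EG G E p X) := by
  have hb : ∀ X Y : LieAlg EG G, chartMetric g p (extChartAt 𝓘(ℝ, E) p p)
      (fundField (actChart EG G E p) (oneCoord EG G) X (extChartAt 𝓘(ℝ, E) p p))
      (fundField (actChart EG G E p) (oneCoord EG G) Y (extChartAt 𝓘(ℝ, E) p p)) =
      pulledBack g p X Y := by
    intro X Y
    rw [fundField_actChart_self, fundField_actChart_self, chartMetric_self, pulledBack_eq]
  have h := (isKillingFamily_fundField hg hp).le_localRicci (isLocalMetric_chartMetric g p)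
    (X := X) (fun Y => by rw [hb, hX]) (fun Y => by simp only [hb, hneg]) Y
    (fun i j => by rw [hb, hY])
  rw [ricci_fundVec]
  simpa only [hb] using h

end InvariantMetric

/-! ### Ideals on which an inner product is infinitesimally invariant -/

section SkewIdeal

variable {𝔤 : Type*} [LieRing 𝔤] [LieAlgebra ℝ 𝔤]

/-- The subspace `s` is an ideal of `𝔤` without central elements, and `ad X` is skew for the inner
product `Q` on all of `𝔤` whenever `X ∈ s`. -/
structure IsSkewIdeal (Q : LinearMap.BilinForm ℝ 𝔤) (s : Submodule ℝ 𝔤) : Prop where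
  symm : ∀ X Y, Q X Y = Q Y X
  pos : ∀ X, X ≠ 0 → 0 < Q X X
  ideal : ∀ X : 𝔤, ∀ Y ∈ s, ⁅X, Y⁆ ∈ s
  skew : ∀ X ∈ s, ∀ Y Z : 𝔤, Q ⁅X, Y⁆ Z = -Q Y ⁅X, Z⁆
  center : ∀ X ∈ s, (∀ Y : 𝔤, ⁅X, Y⁆ = 0) → X = 0

/-- An ideal spanned by brackets of elements with skew adjoint is automatically free of central
elements, since those are orthogonal to all brackets. -/
theorem IsSkewIdeal.of_span {Q : LinearMap.BilinForm ℝ 𝔤} (hs : ∀ X Y, Q X Y = Q Y X)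
    (hp : ∀ X, X ≠ 0 → 0 < Q X X) {t : Set 𝔤} (ht : ∀ X ∈ t, ∀ Y Z : 𝔤, Q ⁅X, Y⁆ Z = -Q Y ⁅X, Z⁆)
    (hi : ∀ X : 𝔤, ∀ Y ∈ Submodule.span ℝ {Z | ∃ A ∈ t, ∃ B ∈ t, ⁅A, B⁆ = Z},
      ⁅X, Y⁆ ∈ Submodule.span ℝ {Z | ∃ A ∈ t, ∃ B ∈ t, ⁅A, B⁆ = Z}) :
    IsSkewIdeal Q (Submodule.span ℝ {Z | ∃ A ∈ t, ∃ B ∈ t, ⁅A, B⁆ = Z}) where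
  symm := hs
  pos := hp
  ideal := hi
  skew := by
    intro X hX
    induction hX using Submodule.span_induction with
    | mem X hX =>
      obtain ⟨A, hA, B, hB, rfl⟩ := hX
      intro Y Z
      rw [lie_lie, lie_lie, map_sub, map_sub, LinearMap.sub_apply, ht A hA, ht B hB, ht B hB,
        ht A hA]
      ring
    | zero => simp
    | add X X' _ _ h h' =>
      intro Y Z
      simp only [add_lie, map_add, LinearMap.add_apply, h Y Z, h' Y Z]
      ring
    | smul r X _ h =>
      intro Y Z
      simp only [smul_lie, map_smul, LinearMap.smul_apply, h Y Z, smul_neg]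
  center := by
    intro X hX hc
    by_contra h0
    have h : ∀ Z ∈ Submodule.span ℝ {Z | ∃ A ∈ t, ∃ B ∈ t, ⁅A, B⁆ = Z}, Q Z X = 0 := by
      intro Z hZ
      induction hZ using Submodule.span_induction with
      | mem Z hZ =>
        obtain ⟨A, hA, B, hB, rfl⟩ := hZ
        rw [ht A hA, ← lie_skew, hc]
        simp
      | zero => simp
      | add Z Z' _ _ h h' => simp [h, h']
      | smul r Z _ h => simp [h]
    exact (hp X h0).ne' (h X hX)

namespace IsSkewIdeal

variable [FiniteDimensional ℝ 𝔤] {Q : LinearMap.BilinForm ℝ 𝔤} {s : Submodule ℝ 𝔤}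

theorem nonneg (S : IsSkewIdeal Q s) (X : 𝔤) : 0 ≤ Q X X := by
  by_cases h : X = 0
  · simp [h]
  · exact (S.pos X h).le

theorem eq_zero (S : IsSkewIdeal Q s) {X : 𝔤} (h : Q X X = 0) : X = 0 := by
  by_contra h0
  exact (S.pos X h0).ne' h

theorem lie_mem (S : IsSkewIdeal Q s) {X : 𝔤} (hX : X ∈ s) (Y : 𝔤) : ⁅X, Y⁆ ∈ s := by
  rw [← lie_skew]
  exact s.neg_mem (S.ideal Y X hX)

/-- The Killing form is negative definite on the ideal, as `-B(X, X)` is the sum of the squared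
lengths of the vectors `[X, b_i]` for an orthonormal basis `b_i`. -/
theorem killingForm_neg (S : IsSkewIdeal Q s) {X : 𝔤} (hX : X ∈ s) (h0 : X ≠ 0) :
    killingForm ℝ 𝔤 X X < 0 := by
  obtain ⟨b, -, hb, -⟩ := exists_orthonormalFor_diagonal Q Q S.symm S.pos S.symm
  have h : killingForm ℝ 𝔤 X X = -∑ i, Q ⁅X, b i⁆ ⁅X, b i⁆ := by
    rw [killingForm_apply_apply, hb.trace_eq, ← Finset.sum_neg_distrib]
    refine Finset.sum_congr rfl fun i _ => ?_
    simp only [LinearMap.comp_apply, LieAlgebra.ad_apply]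
    rw [S.skew X hX]
  rw [h, neg_lt_zero]
  refine lt_of_le_of_ne (Finset.sum_nonneg fun i _ => S.nonneg _) fun hz => h0 (S.center X hX ?_)
  have hz' := (Finset.sum_eq_zero_iff_of_nonneg fun i _ => S.nonneg _).1 hz.symm
  have had : LieAlgebra.ad ℝ 𝔤 X = 0 := b.ext fun i => by
    simpa using S.eq_zero (hz' i (Finset.mem_univ i))
  intro Y
  simpa using DFunLike.congr_fun had Y

end IsSkewIdeal

/-! ### The algebraic estimate at a maximal eigenvector -/

theorem exists_orthogonal_decomposition [FiniteDimensional ℝ 𝔤] {Q : LinearMap.BilinForm ℝ 𝔤}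
    (hs : ∀ X Y, Q X Y = Q Y X) (hp : ∀ X, X ≠ 0 → 0 < Q X X) (U : Submodule ℝ 𝔤) (X : 𝔤) :
    ∃ Y ∈ U, ∀ Z ∈ U, Q (X - Y) Z = 0 := by
  obtain ⟨f, -, hf, -⟩ := exists_orthonormalFor_diagonal (Q.restrict U) (Q.restrict U)
    (fun x y => hs x y) (fun x hx => hp x fun h => hx (Subtype.ext h)) (fun x y => hs x y)
  have hf' : ∀ i j, Q (f i) (f j) = if i = j then 1 else 0 := hf
  refine ⟨∑ i, Q X (f i) • (f i : 𝔤), U.sum_mem fun i _ => U.smul_mem _ (f i).2, fun Z hZ => ?_⟩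
  have h : (Q (X - ∑ i, Q X (f i) • (f i : 𝔤))).domRestrict U = 0 := f.ext fun j => by
    simp [hf']
  exact DFunLike.congr_fun h ⟨Z, hZ⟩

/-- The family `e` consists of eigenvectors of the form `b` with respect to `Q`, with eigenvalues
`lam`, and is a `Q`-orthonormal basis of the orthogonal complement of `s ∩ 𝔥` in `s`. -/
structure IsDiagonalFrame {n : ℕ} (Q b : LinearMap.BilinForm ℝ 𝔤) (s 𝔥 : Submodule ℝ 𝔤)
    (e : Fin n → 𝔤) (lam : Fin n → ℝ) : Prop where
  mem : ∀ i, e i ∈ s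
  orthonormal : OrthonormalFor Q e
  mem_iff : ∀ W ∈ s, W ∈ 𝔥 ↔ ∀ i, Q W (e i) = 0
  diag : ∀ i, ∀ Z ∈ s, b (e i) Z = lam i * Q (e i) Z
  lam_pos : ∀ i, 0 < lam i

section Frame

variable [FiniteDimensional ℝ 𝔤] {Q b : LinearMap.BilinForm ℝ 𝔤} {s 𝔥 : Submodule ℝ 𝔤}

theorem exists_isDiagonalFrame (hs : ∀ X Y, Q X Y = Q Y X) (hp : ∀ X, X ≠ 0 → 0 < Q X X)
    (bs : ∀ X Y, b X Y = b Y X) (bh : ∀ X ∈ 𝔥, ∀ Y, b X Y = 0) (bp : ∀ X, X ∉ 𝔥 → 0 < b X X) :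
    ∃ e lam, IsDiagonalFrame
      (n := Module.finrank ℝ (s ⊓ Q.orthogonal (s ⊓ 𝔥) : Submodule ℝ 𝔤)) Q b s 𝔥 e lam := by
  set V : Submodule ℝ 𝔤 := s ⊓ Q.orthogonal (s ⊓ 𝔥) with hV
  obtain ⟨e, lam, he, hel⟩ := exists_orthonormalFor_diagonal (Q.restrict V) (b.restrict V)
    (fun x y => hs x y) (fun x hx => hp x fun h => hx (Subtype.ext h)) (fun x y => bs x y)
  have he' : ∀ i j, Q (e i) (e j) = if i = j then 1 else 0 := he
  have hel' : ∀ i, ∀ Z ∈ V, b (e i) Z = lam i * Q (e i) Z := fun i Z hZ => hel i ⟨Z, hZ⟩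
  have hdec : ∀ W ∈ s, ∃ Y ∈ s ⊓ 𝔥, W - Y ∈ V := by
    intro W hW
    obtain ⟨Y, hY, hYo⟩ := exists_orthogonal_decomposition hs hp (s ⊓ 𝔥) W
    exact ⟨Y, hY, s.sub_mem hW hY.1, fun Z hZ => (hs _ _).trans (hYo Z hZ)⟩
  have hperp : ∀ W ∈ s ⊓ 𝔥, ∀ Z ∈ V, Q W Z = 0 := fun W hW Z hZ => hZ.2 W hW
  refine ⟨fun i => e i, lam, fun i => (e i).2.1, he', fun W hW => ⟨fun h i => ?_, fun h => ?_⟩,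
    fun i Z hZ => ?_, fun i => ?_⟩
  · exact hperp W ⟨hW, h⟩ _ (e i).2
  · obtain ⟨Y, hY, hYV⟩ := hdec W hW
    have h0 := he.sum_smul ⟨W - Y, hYV⟩
    have h1 : ∀ i, Q.restrict V ⟨W - Y, hYV⟩ (e i) = 0 := fun i => by
      change Q (W - Y) (e i) = 0
      rw [map_sub, LinearMap.sub_apply, h i, hperp Y hY _ (e i).2, sub_zero]
    simp only [h1, zero_smul, Finset.sum_const_zero] at h0
    have h2 : W - Y = 0 := (congrArg Subtype.val h0).symm
    rw [sub_eq_zero.1 h2]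
    exact hY.2
  · obtain ⟨Y, hY, hYV⟩ := hdec Z hZ
    have h1 := hel' i _ hYV
    rwa [map_sub, map_sub, bs (e i) Y, bh Y hY.2, hs (e i) Y, hperp Y hY _ (e i).2, sub_zero,
      sub_zero] at h1
  · have h1 := hel' i _ (e i).2
    rw [he', if_pos rfl, mul_one] at h1
    rw [← h1]
    refine bp _ fun h => ?_
    have h2 := hperp _ ⟨(e i).2.1, h⟩ _ (e i).2
    simp [he'] at h2

namespace IsDiagonalFrame

variable {n : ℕ} {e : Fin n → 𝔤} {lam : Fin n → ℝ}

theorem sub_sum_mem (F : IsDiagonalFrame Q b s 𝔥 e lam) {W : 𝔤} (hW : W ∈ s) :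
    W - ∑ j, Q W (e j) • e j ∈ 𝔥 := by
  have h1 : W - ∑ j, Q W (e j) • e j ∈ s :=
    s.sub_mem hW (s.sum_mem fun i _ => s.smul_mem _ (F.mem i))
  refine (F.mem_iff _ h1).2 fun i => ?_
  simp [F.orthonormal _ i]

theorem apply_self (F : IsDiagonalFrame Q b s 𝔥 e lam) (hs : ∀ X Y, Q X Y = Q Y X)
    (bh : ∀ X ∈ 𝔥, ∀ Y, b X Y = 0) {W : 𝔤} (hW : W ∈ s) :
    b W W = ∑ j, lam j * Q W (e j) ^ 2 := by
  have h := bh _ (F.sub_sum_mem hW) W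
  rw [map_sub, LinearMap.sub_apply, sub_eq_zero] at h
  rw [h]
  simp only [map_sum, map_smul, LinearMap.sum_apply, LinearMap.smul_apply, F.diag _ W hW,
    smul_eq_mul]
  refine Finset.sum_congr rfl fun j _ => ?_
  rw [hs (e j)]
  ring

theorem apply_self_le (F : IsDiagonalFrame Q b s 𝔥 e lam) (S : IsSkewIdeal Q s)
    (bh : ∀ X ∈ 𝔥, ∀ Y, b X Y = 0) {p : ℝ} (hp : 0 ≤ p) (hlam : ∀ i, lam i ≤ p)
    {W : 𝔤} (hW : W ∈ s) : b W W ≤ p * Q W W := by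
  rw [F.apply_self S.symm bh hW]
  refine le_trans ?_ (mul_le_mul_of_nonneg_left
    (F.orthonormal.sum_sq_le S.symm S.pos W) hp)
  rw [Finset.mul_sum]
  exact Finset.sum_le_sum fun i _ => mul_le_mul_of_nonneg_right (hlam i) (sq_nonneg _)

/-- `-tr (ad X)²` in terms of a frame: `ad X` vanishes on the complement of `s`, and it maps
`s ∩ 𝔥` into the span of the frame. -/
theorem neg_killingForm (F : IsDiagonalFrame Q b s 𝔥 e lam) (S : IsSkewIdeal Q s)
    (hlie : ∀ X ∈ 𝔥, ∀ Y ∈ 𝔥, ⁅X, Y⁆ ∈ 𝔥) {X : 𝔤} (hX : X ∈ s)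
    (hXh : ∀ W ∈ s, W ∈ 𝔥 → Q X W = 0) :
    -killingForm ℝ 𝔤 X X =
      2 * ∑ i, Q ⁅X, e i⁆ ⁅X, e i⁆ - ∑ i, ∑ j, Q ⁅X, e i⁆ (e j) ^ 2 := by
  rw [killingForm_apply_apply]
  refine F.orthonormal.trace_skew_sq S.symm S.pos (LieAlgebra.ad ℝ 𝔤 X) (S.skew X hX) ?_
  -- the orthogonal complement of the frame is `s ∩ 𝔥` plus the orthogonal complement of `s`
  have hdec : ∀ x, (∀ i, Q x (e i) = 0) → ∃ x' ∈ s, x' ∈ 𝔥 ∧ ∀ Z ∈ s, Q (x - x') Z = 0 := by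
    intro x hx
    obtain ⟨x', hx', h⟩ := exists_orthogonal_decomposition S.symm S.pos s x
    refine ⟨x', hx', (F.mem_iff x' hx').2 fun i => ?_, h⟩
    have := h (e i) (F.mem i)
    rw [map_sub, LinearMap.sub_apply, hx i] at this
    linarith
  intro x hx y hy
  obtain ⟨x', hx's, hx'h, hxo⟩ := hdec x hx
  obtain ⟨y', hy's, hy'h, hyo⟩ := hdec y hy
  have h1 : ⁅X, x - x'⁆ = 0 := S.eq_zero (by
    rw [S.skew X hX, hxo _ (S.ideal X _ (S.lie_mem hX _)), neg_zero])
  have h2 : ⁅X, x⁆ = ⁅X, x'⁆ := by rwa [lie_sub, sub_eq_zero] at h1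
  have h3 := hyo ⁅X, x'⁆ (S.lie_mem hX x')
  rw [map_sub, LinearMap.sub_apply, sub_eq_zero] at h3
  rw [LieAlgebra.ad_apply, h2, S.symm, h3, S.symm, ← lie_skew, map_neg, LinearMap.neg_apply,
    S.skew x' hx's, neg_neg]
  exact hXh _ (S.lie_mem hx's y') (hlie x' hx'h y' hy'h)

end IsDiagonalFrame

/-- The elementary inequality behind the estimate. After symmetrization in `i` and `j` it amounts to
`a² - ab + b² ≤ p²` for `0 < a, b ≤ p`. -/
theorem quarter_le_of_antisymm {n : ℕ} {lam N : Fin n → ℝ} {c : Fin n → Fin n → ℝ} {p : ℝ}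
    (hpos : ∀ i, 0 < lam i) (hp : ∀ i, lam i ≤ p) (hc : ∀ i j, c i j = -c j i)
    (hN : ∀ i, ∑ j, c i j ^ 2 ≤ N i) :
    1 / 4 * (2 * ∑ i, N i - ∑ i, ∑ j, c i j ^ 2) ≤
      ∑ i, (lam i)⁻¹ * (p * N i - ∑ j, lam j * c i j ^ 2) +
        ∑ i, ∑ j, 1 / 4 * ((lam i)⁻¹ * (lam j)⁻¹ * ((lam i + lam j - p) * c i j) ^ 2) := by
  -- `f i j` collects what is left after `N i` is replaced by its lower bound
  let f : Fin n → Fin n → ℝ := fun i j =>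
    ((lam i)⁻¹ * p - 1 / 2) * c i j ^ 2 - (lam i)⁻¹ * (lam j * c i j ^ 2)
      + 1 / 4 * ((lam i)⁻¹ * (lam j)⁻¹ * ((lam i + lam j - p) * c i j) ^ 2) + 1 / 4 * c i j ^ 2
  have hf : ∀ i j, 0 ≤ f i j + f j i := by
    intro i j
    have ha := hpos i
    have hb := hpos j
    have hpa := hp i
    have hpb := hp j
    have e : f i j + f j i = (lam i)⁻¹ * (lam j)⁻¹ * (1 / 2) *
        (p ^ 2 - (lam i ^ 2 - lam i * lam j + lam j ^ 2)) * c i j ^ 2 := by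
      simp only [f, hc j i]
      field_simp
      ring
    rw [e]
    have : lam i ^ 2 - lam i * lam j + lam j ^ 2 ≤ p ^ 2 := by
      rcases le_total (lam i) (lam j) with h | h <;> nlinarith
    have : 0 ≤ p ^ 2 - (lam i ^ 2 - lam i * lam j + lam j ^ 2) := by linarith
    positivity
  have hsum : 0 ≤ ∑ i, ∑ j, f i j := by
    have h1 : 0 ≤ ∑ i, ∑ j, (f i j + f j i) :=
      Finset.sum_nonneg fun i _ => Finset.sum_nonneg fun j _ => hf i j
    have h2 : ∑ i, ∑ j, f j i = ∑ i, ∑ j, f i j := Finset.sum_comm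
    simp only [Finset.sum_add_distrib] at h1
    linarith
  have hi : ∀ i, ∑ j, f i j ≤ (lam i)⁻¹ * (p * N i - ∑ j, lam j * c i j ^ 2)
      + ∑ j, 1 / 4 * ((lam i)⁻¹ * (lam j)⁻¹ * ((lam i + lam j - p) * c i j) ^ 2)
      - 1 / 4 * (2 * N i - ∑ j, c i j ^ 2) := by
    intro i
    simp only [f, Finset.sum_add_distrib, Finset.sum_sub_distrib, ← Finset.mul_sum]
    have h1 : 1 ≤ (lam i)⁻¹ * p := by
      rw [inv_mul_eq_div, one_le_div (hpos i)]
      exact hp i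
    have h2 := mul_le_mul_of_nonneg_left (hN i) (show 0 ≤ (lam i)⁻¹ * p - 1 / 2 by linarith)
    linarith
  have h := Finset.sum_le_sum fun i (_ : i ∈ Finset.univ) => hi i
  simp only [Finset.sum_add_distrib, Finset.sum_sub_distrib, ← Finset.mul_sum] at h hsum ⊢
  linarith

end Frame

end SkewIdeal

section Frame

variable {𝔤 : Type*} [LieRing 𝔤] [LieAlgebra ℝ 𝔤]
  [FiniteDimensional ℝ 𝔤] {Q b : LinearMap.BilinForm ℝ 𝔤} {s 𝔥 : Submodule ℝ 𝔤}
  {n : ℕ} {e : Fin n → 𝔤} {lam : Fin n → ℝ} {p : ℝ} {X : 𝔤}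

namespace IsDiagonalFrame

/-- An eigenvector of `b` in the complement of `s ∩ 𝔥` is an eigenvector on all of `s`. -/
theorem apply_eq_of_eigen (F : IsDiagonalFrame Q b s 𝔥 e lam) (hs : ∀ X Y, Q X Y = Q Y X)
    (bs : ∀ X Y, b X Y = b Y X) (bh : ∀ X ∈ 𝔥, ∀ Y, b X Y = 0)
    (hX : X ∈ s ⊓ Q.orthogonal (s ⊓ 𝔥))
    (hb : ∀ Z ∈ s ⊓ Q.orthogonal (s ⊓ 𝔥), b X Z = p * Q X Z) {Z : 𝔤} (hZ : Z ∈ s) :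
    b X Z = p * Q X Z := by
  have he : ∀ i, e i ∈ s ⊓ Q.orthogonal (s ⊓ 𝔥) := fun i =>
    ⟨F.mem i, fun W hW => (F.mem_iff W hW.1).1 hW.2 i⟩
  have h1 : ∑ j, Q Z (e j) • e j ∈ s ⊓ Q.orthogonal (s ⊓ 𝔥) :=
    Submodule.sum_mem _ fun i _ => Submodule.smul_mem _ _ (he i)
  have h2 := F.sub_sum_mem hZ
  have h3 : b X (Z - ∑ j, Q Z (e j) • e j) = 0 := by rw [bs, bh _ h2]
  have h4 : Q X (Z - ∑ j, Q Z (e j) • e j) = 0 := by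
    rw [hs]
    exact hX.2 _ ⟨s.sub_mem hZ h1.1, h2⟩
  have h5 := hb _ h1
  rw [map_sub, sub_eq_zero] at h3 h4
  rw [h3, h4, h5]

/-- The squared length of the Killing field of an eigenvector is critical. -/
theorem apply_lie_eq_zero (S : IsSkewIdeal Q s) (hX : X ∈ s)
    (hbX : ∀ Z ∈ s, b X Z = p * Q X Z) (Y : 𝔤) : b X ⁅X, Y⁆ = 0 := by
  have h := S.skew X hX X Y
  rw [lie_self, map_zero, LinearMap.zero_apply] at h
  rw [hbX _ (S.lie_mem hX Y)]
  linear_combination p * h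

theorem apply_lie_lie (S : IsSkewIdeal Q s) (hX : X ∈ s)
    (hbX : ∀ Z ∈ s, b X Z = p * Q X Z) (Y : 𝔤) :
    b X ⁅⁅X, Y⁆, Y⁆ = -(p * Q ⁅X, Y⁆ ⁅X, Y⁆) := by
  have hW := S.lie_mem hX Y
  have h1 := S.skew _ hW X Y
  have h2 := S.skew X hX ⁅X, Y⁆ Y
  rw [← lie_skew ⁅X, Y⁆ X, map_neg, LinearMap.neg_apply, h2] at h1
  rw [hbX _ (S.lie_mem hW Y)]
  linear_combination p * h1

/-- The squared length of the Killing field of an eigenvector for the largest eigenvalue has a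
negative semidefinite Hessian. -/
theorem apply_lie_add_nonpos (F : IsDiagonalFrame Q b s 𝔥 e lam) (S : IsSkewIdeal Q s)
    (bh : ∀ X ∈ 𝔥, ∀ Y, b X Y = 0) (hp : 0 ≤ p) (hlam : ∀ i, lam i ≤ p) (hX : X ∈ s)
    (hbX : ∀ Z ∈ s, b X Z = p * Q X Z) (Y : 𝔤) :
    b ⁅X, Y⁆ ⁅X, Y⁆ + b X ⁅⁅X, Y⁆, Y⁆ ≤ 0 := by
  have := F.apply_self_le S bh hp hlam (S.lie_mem hX Y)
  rw [apply_lie_lie S hX hbX]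
  linarith

/-- The eigenvectors of `b`, normalized to be orthonormal for `b` instead of `Q`. -/
theorem apply_normalized (F : IsDiagonalFrame Q b s 𝔥 e lam) (i j : Fin n) :
    b ((√(lam i))⁻¹ • e i) ((√(lam j))⁻¹ • e j) = if i = j then 1 else 0 := by
  have h := F.orthonormal i j
  simp only [map_smul, LinearMap.smul_apply, F.diag i _ (F.mem j), h, smul_eq_mul]
  split_ifs with hij
  · subst hij
    have h1 := Real.mul_self_sqrt (F.lam_pos i).le
    have h2 := (Real.sqrt_pos.2 (F.lam_pos i)).ne'
    field_simp
    rw [sq, h1]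
  · simp

/-- The lower bound for the Ricci curvature, evaluated in the normalized frame, is at least
`-B(X, X) / 4`. -/
theorem neg_killingForm_le (F : IsDiagonalFrame Q b s 𝔥 e lam) (S : IsSkewIdeal Q s)
    (hlie : ∀ X ∈ 𝔥, ∀ Y ∈ 𝔥, ⁅X, Y⁆ ∈ 𝔥) (bs : ∀ X Y, b X Y = b Y X)
    (bh : ∀ X ∈ 𝔥, ∀ Y, b X Y = 0) (hlam : ∀ i, lam i ≤ p)
    (hX : X ∈ s) (hXh : ∀ W ∈ s, W ∈ 𝔥 → Q X W = 0) (hbX : ∀ Z ∈ s, b X Z = p * Q X Z)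
    {Y : Fin n → 𝔤} (hY : ∀ i, Y i = (√(lam i))⁻¹ • e i) :
    -killingForm ℝ 𝔤 X X / 4 ≤
      ∑ i, -(b ⁅X, Y i⁆ ⁅X, Y i⁆ + b X ⁅⁅X, Y i⁆, Y i⁆)
      + ∑ i, ∑ j, 1 / 4 * (b ⁅X, Y i⁆ (Y j) + b (Y i) ⁅Y j, X⁆ + b X ⁅Y j, Y i⁆) ^ 2 := by
  have hsq : ∀ i, (√(lam i))⁻¹ ^ 2 = (lam i)⁻¹ := fun i => by
    rw [inv_pow, Real.sq_sqrt (F.lam_pos i).le]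
  have hc : ∀ i j, Q ⁅X, e i⁆ (e j) = -Q ⁅X, e j⁆ (e i) := fun i j => by
    rw [S.skew X hX, S.symm]
  have h1 : ∀ i, -(b ⁅X, Y i⁆ ⁅X, Y i⁆ + b X ⁅⁅X, Y i⁆, Y i⁆) = (lam i)⁻¹ *
      (p * Q ⁅X, e i⁆ ⁅X, e i⁆ - ∑ j, lam j * Q ⁅X, e i⁆ (e j) ^ 2) := by
    intro i
    rw [apply_lie_lie S hX hbX, hY]
    simp only [lie_smul, map_smul, LinearMap.smul_apply, smul_eq_mul,
      F.apply_self S.symm bh (S.lie_mem hX (e i)), ← hsq i]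
    ring
  have h2 : ∀ i j, (b ⁅X, Y i⁆ (Y j) + b (Y i) ⁅Y j, X⁆ + b X ⁅Y j, Y i⁆) ^ 2 =
      (lam i)⁻¹ * (lam j)⁻¹ * ((lam i + lam j - p) * Q ⁅X, e i⁆ (e j)) ^ 2 := by
    intro i j
    have e1 : b ⁅X, e i⁆ (e j) = lam j * Q ⁅X, e i⁆ (e j) := by
      rw [bs, F.diag j _ (S.lie_mem hX _), S.symm]
    have e2 : b (e i) ⁅e j, X⁆ = lam i * Q ⁅X, e i⁆ (e j) := by
      rw [F.diag i _ (S.ideal _ _ hX), ← lie_skew, map_neg, S.symm, hc i j]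
    have e3 : b X ⁅e j, e i⁆ = -(p * Q ⁅X, e i⁆ (e j)) := by
      rw [hbX _ (S.ideal _ _ (F.mem i)), hc i j]
      have := S.skew (e j) (F.mem j) X (e i)
      rw [← lie_skew, map_neg, LinearMap.neg_apply] at this
      linear_combination p * this
    rw [hY, hY]
    simp only [lie_smul, smul_lie, map_smul, LinearMap.smul_apply, smul_eq_mul, e1, e2, e3, ← hsq]
    ring
  have h3 := quarter_le_of_antisymm F.lam_pos hlam hc
    (fun i => F.orthonormal.sum_sq_le S.symm S.pos ⁅X, e i⁆)
  rw [F.neg_killingForm S hlie hX hXh]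
  simp only [h1, h2]
  linarith

end IsDiagonalFrame

end Frame

/-! ### The adjoint action and its derivative along curves -/

section AdjointAction

open Filter Topology

variable {EG : Type*} [NormedAddCommGroup EG] [NormedSpace ℝ EG] [FiniteDimensional ℝ EG]
  {G : Type*} [TopologicalSpace G] [ChartedSpace EG G] [Group G] [LieGroup 𝓘(ℝ, EG) ∞ G]

instance instFiniteDimensionalLieAlg : FiniteDimensional ℝ (LieAlg EG G) :=
  inferInstanceAs (FiniteDimensional ℝ EG)

theorem Ad_add (a : G) (X Y : LieAlg EG G) : Ad a (X + Y) = Ad a X + Ad a Y :=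
  map_add (dmap EG EG (fun x : G => a * x * a⁻¹) 1) X Y

theorem Ad_smul (a : G) (c : ℝ) (X : LieAlg EG G) : Ad a (c • X) = c • Ad a X :=
  map_smul (dmap EG EG (fun x : G => a * x * a⁻¹) 1) c X

theorem Ad_zero (a : G) : Ad a (0 : LieAlg EG G) = 0 :=
  map_zero (dmap EG EG (fun x : G => a * x * a⁻¹) 1)

theorem mdifferentiableAt_conj (a b : G) :
    MDifferentiableAt 𝓘(ℝ, EG) 𝓘(ℝ, EG) (fun x : G => a * x * a⁻¹) b :=
  mdifferentiableAt_right (EG := EG) (f := fun (a b : G) => a * b * a⁻¹) contMDiff_conj a b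

theorem Ad_mul (a b : G) (X : LieAlg EG G) : Ad (a * b) X = Ad a (Ad b X) := by
  have h := dmap_comp (f := fun x : G => b * x * b⁻¹) (g := fun x : G => a * x * a⁻¹)
    (mdifferentiableAt_conj a (b * 1 * b⁻¹)) (mdifferentiableAt_conj (EG := EG) b 1)
  have h1 : (fun x : G => a * (b * x * b⁻¹) * a⁻¹) = fun x => (a * b) * x * (a * b)⁻¹ := by
    ext x
    group
  rw [h1, mul_one, mul_inv_cancel] at h
  exact DFunLike.congr_fun h X

/-- The derivative at `0` of `t ↦ Ad(γ(t)) Y` is the bracket of the velocity of `γ` with `Y`. -/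
theorem hasDerivAt_Ad {γ : ℝ → G} (hγ : MDifferentiableAt 𝓘(ℝ, ℝ) 𝓘(ℝ, EG) γ 0) (h0 : γ 0 = 1)
    {X : LieAlg EG G} (hX : (dmap ℝ EG γ 0 1 : EG) = X) (Y : LieAlg EG G) :
    HasDerivAt (fun t => (Ad (γ t) Y : EG)) (⁅X, Y⁆ : LieAlg EG G) 0 := by
  obtain ⟨L, hL, hLX⟩ := exists_hasFDerivAt_Ad Y
  have hc : MDifferentiableAt 𝓘(ℝ, EG) 𝓘(ℝ, EG) (extChartAt 𝓘(ℝ, EG) (1 : G)) (γ 0) := by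
    rw [h0]
    exact mdifferentiableAt_chart one_mem_chart_source
  have h1 := dmap_comp hc hγ
  rw [dmap_eq_fderiv, h0, dmap_extChartAt_self, ContinuousLinearMap.id_comp] at h1
  have h2 : DifferentiableAt ℝ (fun t => extChartAt 𝓘(ℝ, EG) (1 : G) (γ t)) 0 :=
    (MDifferentiableAt.comp (0 : ℝ) hc hγ).differentiableAt
  have h3 := h2.hasFDerivAt.hasDerivAt
  rw [h1] at h3
  have h4 : extChartAt 𝓘(ℝ, EG) (1 : G) (γ 0) = oneCoord EG G := by rw [h0]; rfl
  have h5 : HasDerivAt (fun t => (Ad (ofCoord G (extChartAt 𝓘(ℝ, EG) (1 : G) (γ t))) Y : EG))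
      (L (dmap ℝ EG γ 0 (1 : ℝ))) 0 := by
    rw [← h4] at hL
    exact HasFDerivAt.comp_hasDerivAt (E := EG) (F := EG) (0 : ℝ) hL h3
  have h6 : L (dmap ℝ EG γ 0 (1 : ℝ)) = (⁅X, Y⁆ : LieAlg EG G) := by
    rw [hX]
    exact hLX X
  rw [h6] at h5
  refine HasDerivAt.congr_of_eventuallyEq (F := EG) h5 ?_
  have hs : (extChartAt 𝓘(ℝ, EG) (1 : G)).source ∈ 𝓝 (γ 0) := by
    rw [h0]
    exact extChartAt_source_mem_nhds 1
  filter_upwards [hγ.continuousAt hs] with t ht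
  have : ofCoord G (extChartAt 𝓘(ℝ, EG) (1 : G) (γ t)) = γ t :=
    (extChartAt 𝓘(ℝ, EG) (1 : G)).left_inv ht
  exact congrArg (fun a => (Ad a Y : EG)) this.symm

theorem dmap_conj_comp {γ : ℝ → G} (hγ : MDifferentiableAt 𝓘(ℝ, ℝ) 𝓘(ℝ, EG) γ 0) (h0 : γ 0 = 1)
    {X : LieAlg EG G} (hX : (dmap ℝ EG γ 0 1 : EG) = X) (a : G) :
    (dmap ℝ EG (fun t => a * γ t * a⁻¹) 0 1 : EG) = Ad a X := by
  have h := dmap_comp (mdifferentiableAt_conj a (γ 0)) hγ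
  rw [h0] at h
  rw [h, ContinuousLinearMap.comp_apply, hX]
  rfl

/-- `Ad(a)` respects brackets. This is stated for those `X` that are given as the velocity of a curve
`γ`, and obtained by differentiating `Ad(a γ(t) a⁻¹) Ad(a) Y = Ad(a) Ad(γ(t)) Y`. -/
theorem Ad_lie {γ : ℝ → G} (hγ : MDifferentiableAt 𝓘(ℝ, ℝ) 𝓘(ℝ, EG) γ 0) (h0 : γ 0 = 1)
    {X : LieAlg EG G} (hX : (dmap ℝ EG γ 0 1 : EG) = X) (a : G) (Y : LieAlg EG G) :
    Ad a ⁅X, Y⁆ = ⁅Ad a X, Ad a Y⁆ := by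
  have h1 := (dmap EG EG (fun x : G => a * x * a⁻¹) 1).hasFDerivAt.comp_hasDerivAt (0 : ℝ)
    (hasDerivAt_Ad hγ h0 hX Y)
  have hγ' : MDifferentiableAt 𝓘(ℝ, ℝ) 𝓘(ℝ, EG) (fun t => a * γ t * a⁻¹) 0 :=
    MDifferentiableAt.comp (0 : ℝ) (mdifferentiableAt_conj a (γ 0)) hγ
  have h2 := hasDerivAt_Ad hγ' (by simp [h0]) (dmap_conj_comp hγ h0 hX a) (Ad a Y)
  have h3 : (fun t => (Ad (a * γ t * a⁻¹) (Ad a Y) : EG)) =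
      (dmap EG EG (fun x : G => a * x * a⁻¹) 1) ∘ fun t => (Ad (γ t) Y : EG) := by
    funext t
    rw [← Ad_mul, inv_mul_cancel_right, Ad_mul]
    rfl
  rw [h3] at h2
  exact h1.unique h2

/-! ### The derived algebra of a compact normal subgroup -/

theorem Ad_mem_lieSet {K : Subgroup G} (hK : K.Normal) (a : G) {X : LieAlg EG G}
    (hX : X ∈ lieSet EG K) : Ad a X ∈ lieSet EG K := by
  obtain ⟨γ, hγ, h0, hγK, hγX⟩ := hX
  refine ⟨fun t => a * γ t * a⁻¹, (contMDiff_const.mul hγ).mul contMDiff_const, by simp [h0],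
    fun t => hK.conj_mem _ (hγK t) a, ?_⟩
  exact dmap_conj_comp (hγ.contMDiffAt.mdifferentiableAt (by simp)) h0 hγX a

theorem Ad_mem_derivedLie {K : Subgroup G} (hK : K.Normal) (a : G) {X : LieAlg EG G}
    (hX : X ∈ derivedLie EG K) : Ad a X ∈ derivedLie EG K := by
  induction hX using Submodule.span_induction with
  | mem X hX =>
    obtain ⟨A, hA, B, hB, rfl⟩ := hX
    obtain ⟨γ, hγ, h0, hγK, hγX⟩ := id hA
    rw [Ad_lie (hγ.contMDiffAt.mdifferentiableAt (by simp)) h0 hγX]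
    exact Submodule.subset_span ⟨_, Ad_mem_lieSet hK a hA, _, Ad_mem_lieSet hK a hB, rfl⟩
  | zero => rw [Ad_zero]; exact Submodule.zero_mem _
  | add X Y _ _ hX hY => rw [Ad_add]; exact Submodule.add_mem _ hX hY
  | smul c X _ hX => rw [Ad_smul]; exact Submodule.smul_mem _ c hX

/-- A function with values in a subspace has its derivative in that subspace. -/
theorem fderiv_mem_of_forall_mem {E F : Type*} [NormedAddCommGroup E] [NormedSpace ℝ E]
    [NormedAddCommGroup F] [NormedSpace ℝ F] [FiniteDimensional ℝ F] {S : Submodule ℝ F}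
    {f : E → F} {L : E →L[ℝ] F} {x : E} (hf : HasFDerivAt f L x) (hS : ∀ z, f z ∈ S) (v : E) :
    L v ∈ S := by
  obtain ⟨T, hT⟩ := S.exists_isCompl
  let P := LinearMap.toContinuousLinearMap (T.projection S hT.symm)
  have hP : ∀ y, P y = 0 ↔ y ∈ S := fun y => by
    conv_rhs => rw [← Submodule.ker_projection hT.symm]
    rfl
  have h1 := P.hasFDerivAt.comp x hf
  have h2 : (P ∘ f) = fun _ => 0 := funext fun z => (hP _).2 (hS z)
  rw [h2] at h1
  exact (hP _).1 (DFunLike.congr_fun (h1.unique (hasFDerivAt_const 0 x)) v)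

/-- The derived algebra is an ideal: `[X, Y]` is a derivative of `a ↦ Ad(a) Y`, which has its values in
the derived algebra. -/
theorem lie_mem_derivedLie {K : Subgroup G} (hK : K.Normal) (X : LieAlg EG G) {Y : LieAlg EG G}
    (hY : Y ∈ derivedLie EG K) : ⁅X, Y⁆ ∈ derivedLie EG K := by
  obtain ⟨L, hL, hLX⟩ := exists_hasFDerivAt_Ad Y
  let S : Submodule ℝ EG := derivedLie EG K
  have h := fderiv_mem_of_forall_mem (S := S) hL (fun z => Ad_mem_derivedLie hK _ hY) X
  rw [hLX] at h
  exact h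

/-- The derivative of the invariance of `Q` along a curve in the group. -/
theorem skew_of_mem_lieSet {Q : LinearMap.BilinForm ℝ (LieAlg EG G)} {C K : Subgroup G}
    (hQ : IsAdInvariantInner Q C) (hKC : K ≤ C) {X : LieAlg EG G} (hX : X ∈ lieSet EG K)
    (Y Z : LieAlg EG G) : Q ⁅X, Y⁆ Z = -Q Y ⁅X, Z⁆ := by
  obtain ⟨γ, hγ, h0, hγK, hγX⟩ := hX
  have hd := fun Y => hasDerivAt_Ad (hγ.contMDiffAt.mdifferentiableAt (by simp)) h0 hγX Y
  let Q₀ : EG →ₗ[ℝ] EG →ₗ[ℝ] ℝ := Q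
  let Q' : EG →L[ℝ] EG →L[ℝ] ℝ :=
    LinearMap.toContinuousLinearMap (LinearMap.toContinuousLinearMap.toLinearMap ∘ₗ Q₀)
  have h1 := (Q'.hasFDerivAt.comp_hasDerivAt (0 : ℝ) (hd Y)).clm_apply (hd Z)
  have h2 : (fun t => (Q' ∘ fun t => (Ad (γ t) Y : EG)) t (Ad (γ t) Z : EG)) = fun _ => Q Y Z :=
    funext fun t => hQ.invariant _ (hKC (hγK t)) Y Z
  rw [h2] at h1
  have h3 := h1.unique (hasDerivAt_const (0 : ℝ) (Q Y Z))
  have h4 : Q ⁅X, Y⁆ (Ad (γ 0) Z) + Q (Ad (γ 0) Y) ⁅X, Z⁆ = 0 := h3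
  rw [h0, Ad_one, Ad_one] at h4
  linarith

theorem isSkewIdeal_derivedLie {Q : LinearMap.BilinForm ℝ (LieAlg EG G)} {C K : Subgroup G}
    (hK : K.Normal) (hQ : IsAdInvariantInner Q C) (hKC : K ≤ C) :
    IsSkewIdeal Q (derivedLie EG K) :=
  IsSkewIdeal.of_span hQ.symm hQ.pos (fun _ hX Y Z => skew_of_mem_lieSet hQ hKC hX Y Z)
    (fun X _ hY => lie_mem_derivedLie hK X hY)

/-! ### Almost-effective actions -/

variable {E : Type*} [NormedAddCommGroup E] [NormedSpace ℝ E] [FiniteDimensional ℝ E]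
  {M : Type*} [TopologicalSpace M] [ChartedSpace E M] [IsManifold 𝓘(ℝ, E) ∞ M]
  [MulAction G M] [ContMDiffSMul 𝓘(ℝ, EG) 𝓘(ℝ, E) ∞ G M]

/-- The isotropy algebra is closed under brackets. -/
theorem lie_mem_ker_fundVec (o : M) {X Y : LieAlg EG G}
    (hX : X ∈ LinearMap.ker (fundVec EG G E o)) (hY : Y ∈ LinearMap.ker (fundVec EG G E o)) :
    ⁅X, Y⁆ ∈ LinearMap.ker (fundVec EG G E o) := by
  have h := (fundField_bracket_actChart (E := E) o X Y).self_of_nhds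
  rw [LinearMap.mem_ker] at hX hY ⊢
  rw [fundField_actChart_self, fundField_actChart_self, fundField_actChart_self, hX, hY] at h
  rw [← h, map_zero, map_zero, sub_zero]

/-- An element of `𝔤` whose fundamental field vanishes generates a one-parameter group that acts
trivially, hence is zero if the action is almost-effective. -/
theorem eq_zero_of_fundVec_eq_zero [T2Space G] [T2Space M] {o : M} (heff : IsAlmostEffective G o)
    {X : LieAlg EG G} (hX : ∀ q : M, fundVec EG G E q X = 0) : X = 0 := by
  have hG1 : IsManifold 𝓘(ℝ, EG) 1 G := IsManifold.of_le (n := ∞) (by norm_cast)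
  have hM1 : IsManifold 𝓘(ℝ, E) 1 M := IsManifold.of_le (n := ∞) (by norm_cast)
  have hs : ContMDiff (𝓘(ℝ, EG).prod 𝓘(ℝ, E)) 𝓘(ℝ, E) ∞ (fun x : G × M => x.1 • x.2) :=
    contMDiff_smul
  have hv : ContMDiffAt 𝓘(ℝ, EG) 𝓘(ℝ, EG).tangent 1 (fun x : G =>
      (⟨x, mulInvariantVectorField X x⟩ : TangentBundle 𝓘(ℝ, EG) G)) 1 :=
    (contMDiffAt_mulInvariantVectorField X).of_le (by simp)
  obtain ⟨γ, h0, hγ⟩ := exists_isMIntegralCurveAt_of_contMDiffAt_boundaryless (t₀ := 0) hv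
  obtain ⟨ε, hε, hγε⟩ := Metric.eventually_nhds_iff_ball.1 hγ
  rw [Real.ball_eq_Ioo, zero_sub, zero_add] at hγε
  have h0ε : (0 : ℝ) ∈ Set.Ioo (-ε) ε := ⟨by linarith, hε⟩
  have hconst : ∀ q : M, ∀ t ∈ Set.Ioo (-ε) ε, γ t • q = q := by
    intro q
    -- the derivative of the orbit map at `a` vanishes on the left-invariant field of `X`
    have hd : ∀ a : G, dmap EG E (fun b : G => b • q) a
        (mulInvariantVectorField X a : EG) = 0 := by
      intro a
      have e1 := dmap_comp (f := fun b : G => a * b) (g := fun b : G => b • q)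
        (mdifferentiableAt_left (E := E) (f := fun (a : G) (q : M) => a • q) hs (a * 1) q)
        (contMDiff_mul_left.contMDiffAt.mdifferentiableAt (n := ∞) (by simp))
      have e2 := dmap_comp (f := fun b : G => b • q) (g := fun x : M => a • x)
        (mdifferentiableAt_right (EG := EG) (f := fun (a : G) (q : M) => a • q) hs a ((1 : G) • q))
        (mdifferentiableAt_left (E := E) (f := fun (a : G) (q : M) => a • q) hs 1 q)
      simp only [mul_smul] at e1
      rw [e2, mul_one] at e1
      have e3 : dmap E E (fun x : M => a • x) ((1 : G) • q)
          (dmap EG E (fun b : G => b • q) 1 (X : EG)) =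
          dmap EG E (fun b : G => b • q) a (dmap EG EG (fun b : G => a * b) 1 (X : EG)) :=
        DFunLike.congr_fun e1 (X : EG)
      have e4 : dmap EG E (fun b : G => b • q) 1 (X : EG) = 0 := hX q
      rw [e4, map_zero] at e3
      exact e3.symm
    -- both `t ↦ γ t • q` and the constant curve `q` are integral curves of the zero field
    have hc : IsMIntegralCurveOn (I := 𝓘(ℝ, E)) (fun t => γ t • q) (fun _ => 0)
        (Set.Ioo (-ε) ε) := by
      intro t ht
      have h1 := (mdifferentiableAt_left (EG := EG) (f := fun (a : G) (q : M) => a • q) hs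
        (γ t) q).hasMFDerivAt.comp t (hγε t ht)
      refine (h1.congr_mfderiv ?_).hasMFDerivWithinAt
      refine ContinuousLinearMap.ext fun c : ℝ => ?_
      change dmap EG E (fun b : G => b • q) (γ t) (c • (mulInvariantVectorField X (γ t) : EG)) =
        c • (0 : E)
      exact (map_smul (dmap EG E (fun b : G => b • q) (γ t)) c _).trans
        (congrArg (c • ·) (hd (γ t)))
    have hq : IsMIntegralCurveOn (I := 𝓘(ℝ, E)) (fun _ : ℝ => q) (fun _ => 0)
        (Set.Ioo (-ε) ε) := by
      intro t ht
      refine ((hasMFDerivAt_const q t).congr_mfderiv ?_).hasMFDerivWithinAt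
      refine ContinuousLinearMap.ext fun c : ℝ => ?_
      exact (smul_zero (A := E) c).symm
    have hz : ContMDiff 𝓘(ℝ, E) 𝓘(ℝ, E).tangent 1
        (fun x => (⟨x, 0⟩ : TangentBundle 𝓘(ℝ, E) M)) :=
      Bundle.contMDiff_zeroSection ℝ (TangentSpace 𝓘(ℝ, E) : M → Type _)
    exact isMIntegralCurveOn_Ioo_eqOn_of_contMDiff_boundaryless h0ε hz hc hq (by simp [h0])
  -- hence the integral curve stays in a finite set, and it is constant
  have hcore : ∀ t ∈ Set.Ioo (-ε) ε, γ t ∈ (MulAction.stabilizer G o).normalCore := by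
    intro t ht b
    rw [MulAction.mem_stabilizer_iff, mul_smul, mul_smul, hconst _ t ht, smul_inv_smul]
  have hγ0 := hγε 0 h0ε
  have hnhds : (((MulAction.stabilizer G o).normalCore : Set G) \ {1})ᶜ ∈ 𝓝 (γ 0) := by
    rw [h0]
    exact (heff.subset Set.sdiff_subset).isClosed.isOpen_compl.mem_nhds (by simp)
  have hev : γ =ᶠ[𝓝 0] fun _ => 1 := by
    filter_upwards [hγ0.continuousAt hnhds, Ioo_mem_nhds h0ε.1 h0ε.2] with t ht ht'
    by_contra h1
    exact ht ⟨hcore t ht', h1⟩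
  have h1 := (hγ0.congr_of_eventuallyEq hev.symm).mfderiv
  rw [mfderiv_const] at h1
  have h2 : (0 : EG) = (1 : ℝ) • dmap EG EG (fun b : G => γ 0 * b) 1 (X : EG) :=
    DFunLike.congr_fun h1 (1 : ℝ)
  simp only [h0, one_mul, dmap_id, one_smul] at h2
  exact h2.symm

/-- If the whole derived algebra of a normal subgroup were contained in the isotropy algebra at
`o`, it would act trivially everywhere. -/
theorem derivedLie_not_le_ker [T2Space G] [T2Space M] {o : M} (hM : IsPresentation EG G E o)
    (heff : IsAlmostEffective G o) {K : Subgroup G} (hK : K.Normal)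
    (hnonab : ∃ X ∈ lieSet EG K, ∃ Y ∈ lieSet EG K, ⁅X, Y⁆ ≠ 0) :
    ¬derivedLie EG K ≤ LinearMap.ker (fundVec EG G E o) := by
  intro h
  obtain ⟨X, hX, Y, hY, hne⟩ := hnonab
  refine hne (eq_zero_of_fundVec_eq_zero (E := E) heff fun q => ?_)
  have hXY : ⁅X, Y⁆ ∈ derivedLie EG K := Submodule.subset_span ⟨X, hX, Y, hY, rfl⟩
  have := hM.transitive
  obtain ⟨a, rfl⟩ := MulAction.exists_smul_eq G o q
  have h1 := dmap_smul_fundVec (E := E) a o (Ad a⁻¹ ⁅X, Y⁆)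
  rw [← Ad_mul, mul_inv_cancel, Ad_one, LinearMap.mem_ker.1 (h (Ad_mem_derivedLie hK a⁻¹ hXY)),
    map_zero] at h1
  exact h1.symm

end AdjointAction

/-! ### Averaging over a compact subgroup -/

section Averaging

open Filter Topology MeasureTheory

variable {EG : Type*} [NormedAddCommGroup EG] [NormedSpace ℝ EG] [FiniteDimensional ℝ EG]
  {G : Type*} [TopologicalSpace G] [ChartedSpace EG G] [Group G] [LieGroup 𝓘(ℝ, EG) ∞ G]

/-- The adjoint action is continuous: at `1` because it is differentiable there, elsewhere because
it is multiplicative. -/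
theorem continuous_Ad (X : LieAlg EG G) : Continuous fun a : G => (Ad a X : EG) := by
  have : IsTopologicalGroup G := topologicalGroup_of_lieGroup 𝓘(ℝ, EG) ∞
  have h1 : ContinuousAt (fun a : G => (Ad a X : EG)) 1 := by
    obtain ⟨L, hL, -⟩ := exists_hasFDerivAt_Ad X
    have hL' : ContinuousAt (fun z : EG => (Ad (ofCoord G z) X : EG)) (oneCoord EG G) :=
      HasFDerivAt.continuousAt (E := EG) (F := EG) hL
    have h2 : ContinuousAt (fun a : G => (Ad (ofCoord G (extChartAt 𝓘(ℝ, EG) (1 : G) a)) X : EG)) 1 :=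
      ContinuousAt.comp (f := fun a : G => extChartAt 𝓘(ℝ, EG) (1 : G) a) hL'
        (continuousAt_extChartAt (1 : G))
    refine h2.congr ?_
    filter_upwards [extChartAt_source_mem_nhds (I := 𝓘(ℝ, EG)) (1 : G)] with a ha
    exact congrArg (fun a => (Ad a X : EG)) ((extChartAt 𝓘(ℝ, EG) (1 : G)).left_inv ha)
  rw [continuous_iff_continuousAt]
  intro b
  have h2 : (fun a : G => (Ad a X : EG)) = fun a =>
      dmap EG EG (fun x : G => b * x * b⁻¹) 1 (Ad (b⁻¹ * a) X : EG) := by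
    funext a
    have := Ad_mul b (b⁻¹ * a) X
    rwa [mul_inv_cancel_left] at this
  rw [h2]
  refine (dmap EG EG (fun x : G => b * x * b⁻¹) 1).continuous.continuousAt.comp ?_
  refine ContinuousAt.comp (g := fun a : G => (Ad a X : EG)) (f := fun a => b⁻¹ * a) ?_
    (continuous_const_mul b⁻¹).continuousAt
  rwa [inv_mul_cancel]

/-- A compact subgroup leaves an inner product invariant: the average of `q(Ad(a⁻¹) X, Ad(a⁻¹) Y)` over
the subgroup with respect to Haar measure, where `q` is the inner product of coordinate vectors. -/
theorem exists_isAdInvariantInner {C : Subgroup G} (hC : IsCompact (C : Set G)) :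
    ∃ Q : LinearMap.BilinForm ℝ (LieAlg EG G), IsAdInvariantInner Q C := by
  have : IsTopologicalGroup G := topologicalGroup_of_lieGroup 𝓘(ℝ, EG) ∞
  have : CompactSpace C := isCompact_iff_compactSpace.1 hC
  let _ : MeasurableSpace C := borel C
  have : BorelSpace C := ⟨rfl⟩
  let f := Module.finBasis ℝ EG
  let u : LieAlg EG G → Fin (Module.finrank ℝ EG) → C → ℝ :=
    fun X i a => f.coord i (Ad (a⁻¹ : G) X : EG)
  have hu : ∀ X i, Continuous (u X i) := fun X i =>
    (f.coord i).continuous_of_finiteDimensional.comp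
      ((continuous_Ad X).comp continuous_subtype_val.inv)
  have hadd : ∀ X Y i a, u (X + Y) i a = u X i a + u Y i a := fun X Y i a =>
    (congrArg (f.coord i) (Ad_add _ X Y)).trans (map_add (f.coord i) _ _)
  have hsmul : ∀ (c : ℝ) X i a, u (c • X) i a = c * u X i a := fun c X i a =>
    (congrArg (f.coord i) (Ad_smul _ c X)).trans (map_smul (f.coord i) c _)
  let φ : LieAlg EG G → LieAlg EG G → C → ℝ := fun X Y a => ∑ i, u X i a * u Y i a
  have hφ : ∀ X Y, Continuous (φ X Y) := fun X Y =>
    continuous_finsetSum _ fun i _ => (hu X i).mul (hu Y i)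
  let μ : Measure C := Measure.haar
  have hint : ∀ X Y, Integrable (φ X Y) μ := fun X Y =>
    (hφ X Y).integrable_of_hasCompactSupport (HasCompactSupport.of_compactSpace _)
  refine ⟨LinearMap.mk₂ ℝ (fun X Y => ∫ a, φ X Y a ∂μ) ?_ ?_ ?_ ?_, ?_, ?_, ?_⟩
  · intro X X' Y
    rw [← integral_add (hint _ _) (hint _ _)]
    simp only [φ, hadd, add_mul, Finset.sum_add_distrib]
  · intro c X Y
    rw [smul_eq_mul, ← integral_const_mul]
    simp only [φ, hsmul, mul_assoc, Finset.mul_sum]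
  · intro X Y Y'
    rw [← integral_add (hint _ _) (hint _ _)]
    simp only [φ, hadd, mul_add, Finset.sum_add_distrib]
  · intro c X Y
    rw [smul_eq_mul, ← integral_const_mul]
    simp only [φ, hsmul, mul_left_comm, Finset.mul_sum]
  · intro X Y
    simp only [LinearMap.mk₂_apply, φ, mul_comm]
  · intro X hX
    rw [LinearMap.mk₂_apply]
    refine (hφ X X).integral_pos_of_hasCompactSupport_nonneg_nonzero
      (HasCompactSupport.of_compactSpace _)
      (fun a => Finset.sum_nonneg fun i _ => mul_self_nonneg _) (x := 1) fun h0 => hX ?_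
    have h1 := (Finset.sum_eq_zero_iff_of_nonneg fun i _ => mul_self_nonneg (u X i 1)).1 h0
    have h2 : Ad ((1 : C)⁻¹ : G) X = X := by
      rw [OneMemClass.coe_one, inv_one, Ad_one]
    exact f.ext_elem fun i => by
      have h3 : f.coord i (Ad ((1 : C)⁻¹ : G) X : EG) = 0 :=
        mul_self_eq_zero.1 (h1 i (Finset.mem_univ i))
      rw [h2] at h3
      exact h3.trans (DFunLike.congr_fun (map_zero f.repr) i).symm
  · intro b hb X Y
    rw [LinearMap.mk₂_apply, LinearMap.mk₂_apply,
      ← integral_mul_left_eq_self (fun a => φ (Ad b X) (Ad b Y) a) (⟨b, hb⟩ : C)]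
    have h : ∀ (X : LieAlg EG G) i a, u (Ad b X) i (⟨b, hb⟩ * a) = u X i a := by
      intro X i a
      have : ((((⟨b, hb⟩ : C) * a : C) : G))⁻¹ * b = (a : G)⁻¹ := by
        rw [Subgroup.coe_mul]
        group
      simp only [u]
      rw [← Ad_mul, this]
    simp only [φ, h]

end Averaging

/-! ### The Ricci curvature in the direction of a maximal eigenvector -/

section Homogeneous

variable {EG : Type*} [NormedAddCommGroup EG] [NormedSpace ℝ EG] [FiniteDimensional ℝ EG]
  {G : Type*} [TopologicalSpace G] [ChartedSpace EG G] [Group G] [LieGroup 𝓘(ℝ, EG) ∞ G]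
  {E : Type*} [NormedAddCommGroup E] [NormedSpace ℝ E] [FiniteDimensional ℝ E]
  {M : Type*} [TopologicalSpace M] [ChartedSpace E M] [IsManifold 𝓘(ℝ, E) ∞ M]
  [MulAction G M] [ContMDiffSMul 𝓘(ℝ, EG) 𝓘(ℝ, E) ∞ G M]

/-- `pulledBack g o` as a bilinear form. -/
def pulledBackForm (g : Metric E M) (o : M) : LinearMap.BilinForm ℝ (LieAlg EG G) :=
  LinearMap.mk₂ ℝ (pulledBack g o)
    (fun X X' Y => by
      simp only [pulledBack_eq, map_add]
      rfl)
    (fun c X Y => by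
      simp only [pulledBack_eq, map_smul]
      rfl)
    (fun X Y Y' => by
      simp only [pulledBack_eq, map_add])
    (fun c X Y => by
      simp only [pulledBack_eq, map_smul])

theorem pulledBackForm_apply (g : Metric E M) (o : M) (X Y : LieAlg EG G) :
    pulledBackForm g o X Y = pulledBack g o X Y := rfl

theorem pulledBackForm_symm (g : Metric E M) (o : M) (X Y : LieAlg EG G) :
    pulledBackForm g o X Y = pulledBackForm g o Y X :=
  innerAt_symm g o _ _

theorem pulledBackForm_of_mem_ker (g : Metric E M) (o : M) (X : LieAlg EG G)
    (hX : X ∈ LinearMap.ker (fundVec EG G E o)) (Y : LieAlg EG G) :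
    pulledBackForm g o X Y = 0 := by
  rw [pulledBackForm_apply, pulledBack_eq, LinearMap.mem_ker.1 hX]
  simp

theorem pulledBackForm_pos (g : Metric E M) (o : M) (X : LieAlg EG G)
    (hX : X ∉ LinearMap.ker (fundVec EG G E o)) : 0 < pulledBackForm g o X X :=
  innerAt_pos g o _ hX

/-- The constant `c`, which depends on `𝔪_𝔨` but not on a metric. -/
theorem exists_pos_le_killingForm {Q : LinearMap.BilinForm ℝ (LieAlg EG G)} {K : Subgroup G}
    (S : IsSkewIdeal Q (derivedLie EG K)) (o : M) :
    ∃ c : ℝ, 0 < c ∧ ∀ X ∈ mk EG E K o Q, Q X X = 1 →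
      c ≤ -(killingForm ℝ (LieAlg EG G) X X) / 4 := by
  obtain ⟨c, hc, h⟩ := exists_pos_mul_le (Q := Q.restrict (mk EG E K o Q))
    (P := (-killingForm ℝ (LieAlg EG G)).restrict (mk EG E K o Q))
    (fun x y => S.symm x y) (fun x hx => S.pos x fun h => hx (Subtype.ext h))
    (fun x y => by
      change -killingForm ℝ (LieAlg EG G) x y = -killingForm ℝ (LieAlg EG G) y x
      rw [LieModule.traceForm_comm])
    (fun x hx => neg_pos.2 (S.killingForm_neg x.2.1 fun h => hx (Subtype.ext h)))
  refine ⟨c / 4, by positivity, fun X hX hX1 => ?_⟩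
  have h1 : c * Q X X ≤ -killingForm ℝ (LieAlg EG G) X X := h ⟨X, hX⟩
  rw [hX1] at h1
  linarith

/-- The estimate for eigenvectors of the largest eigenvalue. -/
theorem le_ricci_of_isEigen {g : Metric E M} (hg : IsInvariantMetric G g) {o : M}
    (ho : Function.Surjective (fundVec EG G E o)) {Q : LinearMap.BilinForm ℝ (LieAlg EG G)}
    {K : Subgroup G} (S : IsSkewIdeal Q (derivedLie EG K)) {n : ℕ} {e : Fin n → LieAlg EG G}
    {lam : Fin n → ℝ} (F : IsDiagonalFrame Q (pulledBackForm g o) (derivedLie EG K)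
      (LinearMap.ker (fundVec EG G E o)) e lam)
    {p : ℝ} (hp : 0 ≤ p) (hlam : ∀ i, lam i ≤ p) {X : LieAlg EG G}
    (hX : IsEigen g o Q (mk EG E K o Q) p X) :
    -(killingForm ℝ (LieAlg EG G) X X) / 4 ≤
      ricci g o (fundVec EG G E o X) (fundVec EG G E o X) := by
  have bs := pulledBackForm_symm (EG := EG) (G := G) g o
  have bh := pulledBackForm_of_mem_ker (EG := EG) (G := G) g o
  have hbX : ∀ Z ∈ derivedLie EG K, pulledBackForm g o X Z = p * Q X Z := fun Z hZ =>
    F.apply_eq_of_eigen S.symm bs bh hX.1 hX.2.2 hZ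
  have hXs : X ∈ derivedLie EG K := hX.1.1
  have hXh : ∀ W ∈ derivedLie EG K, W ∈ LinearMap.ker (fundVec EG G E o) → Q X W = 0 :=
    fun W hW hWh => (S.symm X W).trans (hX.1.2 W ⟨hW, hWh⟩)
  refine (F.neg_killingForm_le S (fun A hA B hB => lie_mem_ker_fundVec o hA hB) bs bh hlam hXs hXh
    hbX (Y := fun i => (√(lam i))⁻¹ • e i) fun i => rfl).trans ?_
  exact le_ricci hg ho (fun Y => IsDiagonalFrame.apply_lie_eq_zero S hXs hbX Y)
    (fun Y => F.apply_lie_add_nonpos S bh hp hlam hXs hbX Y) _ F.apply_normalized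

end Homogeneous

end HomogeneousRicci

end

theorem mainTheorem2
    {EG : Type*} [NormedAddCommGroup EG] [NormedSpace ℝ EG] [FiniteDimensional ℝ EG]
    {G : Type*} [TopologicalSpace G] [ChartedSpace EG G] [Group G] [LieGroup 𝓘(ℝ, EG) ∞ G]
    [T2Space G]
    {E : Type*} [NormedAddCommGroup E] [NormedSpace ℝ E] [FiniteDimensional ℝ E]
    {M : Type*} [TopologicalSpace M] [ChartedSpace E M] [IsManifold 𝓘(ℝ, E) ∞ M] [T2Space M]
    [MulAction G M] [ContMDiffSMul 𝓘(ℝ, EG) 𝓘(ℝ, E) ∞ G M]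
    (o : M) (hM : HomogeneousRicci.IsPresentation EG G E o)
    (heff : HomogeneousRicci.IsAlmostEffective G o)
    (K : Subgroup G) (hnormal : K.Normal) (hcompact : IsCompact (K : Set G))
    (hnonab : ∃ X ∈ HomogeneousRicci.lieSet EG K, ∃ Y ∈ HomogeneousRicci.lieSet EG K, ⁅X, Y⁆ ≠ 0) :
    (IsCompact (MulAction.stabilizer G o : Set G) →
      ∃ Q : LinearMap.BilinForm ℝ (HomogeneousRicci.LieAlg EG G),
        HomogeneousRicci.IsAdInvariantInner Q (K ⊔ MulAction.stabilizer G o)) ∧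
    ∀ Q : LinearMap.BilinForm ℝ (HomogeneousRicci.LieAlg EG G),
      HomogeneousRicci.IsAdInvariantInner Q (K ⊔ MulAction.stabilizer G o) →
      ∃ c : ℝ, 0 < c ∧
        (∀ X ∈ HomogeneousRicci.mk EG E K o Q, Q X X = 1 →
          c ≤ -(killingForm ℝ (HomogeneousRicci.LieAlg EG G) X X) / 4) ∧
        ∀ g : HomogeneousRicci.Metric E M, HomogeneousRicci.IsInvariantMetric G g →
          ∃ p : ℝ,
            IsGreatest {r : ℝ | ∃ X, HomogeneousRicci.IsEigen g o Q
              (HomogeneousRicci.mk EG E K o Q) r X} p ∧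
            (∃ X, HomogeneousRicci.IsEigen g o Q (HomogeneousRicci.mk EG E K o Q) p X ∧
              Q X X = 1) ∧
            ∀ X, HomogeneousRicci.IsEigen g o Q (HomogeneousRicci.mk EG E K o Q) p X →
              Q X X = 1 →
              -(killingForm ℝ (HomogeneousRicci.LieAlg EG G) X X) / 4 ≤
                HomogeneousRicci.ricci g o (HomogeneousRicci.fundVec EG G E o X)
                  (HomogeneousRicci.fundVec EG G E o X) := by
  open HomogeneousRicci in
  refine ⟨fun hH => exists_isAdInvariantInner ?_, fun Q hQ => ?_⟩
  · have : IsTopologicalGroup G := topologicalGroup_of_lieGroup 𝓘(ℝ, EG) ∞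
    rw [Subgroup.normal_mul]
    exact hcompact.mul hH
  have S : IsSkewIdeal Q (derivedLie EG K) := isSkewIdeal_derivedLie hnormal hQ le_sup_left
  obtain ⟨c, hc0, hc⟩ := exists_pos_le_killingForm (E := E) S o
  refine ⟨c, hc0, hc, fun g hg => ?_⟩
  have bs := pulledBackForm_symm (EG := EG) (G := G) g o
  have bh := pulledBackForm_of_mem_ker (EG := EG) (G := G) g o
  obtain ⟨e, lam, F⟩ := exists_isDiagonalFrame (s := derivedLie EG K) S.symm S.pos bs bh
    (pulledBackForm_pos g o)
  -- an empty frame would mean that `𝔰` is contained in the isotropy algebra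
  have hne : Nonempty (Fin (Module.finrank ℝ (derivedLie EG K ⊓ Q.orthogonal
      (derivedLie EG K ⊓ LinearMap.ker (fundVec EG G E o)) : Submodule ℝ (LieAlg EG G)))) := by
    by_contra h
    have := not_nonempty_iff.1 h
    exact derivedLie_not_le_ker hM heff hnormal hnonab fun W hW =>
      (F.mem_iff W hW).2 fun i => isEmptyElim i
  obtain ⟨i, hi⟩ := Finite.exists_max lam
  have hi1 : Q (e i) (e i) = 1 := by rw [F.orthonormal, if_pos rfl]
  have hei : IsEigen g o Q (mk EG E K o Q) (lam i) (e i) := by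
    refine ⟨⟨F.mem i, fun W hW => (F.mem_iff W hW.1).1 hW.2 i⟩, fun h0 => ?_,
      fun Z hZ => F.diag i Z hZ.1⟩
    rw [h0] at hi1
    simp at hi1
  refine ⟨lam i, ⟨⟨e i, hei⟩, ?_⟩, ⟨e i, hei, hi1⟩, fun X hX _ =>
    le_ricci_of_isEigen hg hM.submersion S F (F.lam_pos i).le hi hX⟩
  rintro r ⟨X, hXm, hX0, hX⟩
  have h1 := F.apply_self_le S bh (F.lam_pos i).le hi hXm.1
  rw [pulledBackForm_apply, hX X hXm] at h1
  exact le_of_mul_le_mul_right h1 (S.pos X hX0)
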